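/- Let $N>4$ be an integer; all functions are real-valued and functions equal a.e. are identified. Let $D^{2,2}_0(\mathbb R^N)$ be the completion of $C_0^\infty(\mathbb R^N)$ with respect to the norm $\|\varphi\|:=\left(\int_{\mathbb R^N}|\Delta\varphi|^2\,dx\right)^{1/2}$. It is regarded as a space of functions as follows: a measurable function $u$ represents $\xi\in D^{2,2}_0(\mathbb R^N)$ if there are $\varphi_n\in C_0^\infty(\mathbb R^N)$ with $\varphi_n\to\xi$ in the completion and $\varphi_n\to u$ in $L^{2N/(N-4)}(\mathbb R^N)$. Let $$\mathcal S^2(\mathbb R^N):=\left\{u\in H^2_{loc}(\mathbb R^N)\ \Big|\ \Delta u,\ \frac{\nabla u}{|x|},\ \frac{u}{|x|^2}\in L^2(\mathbb R^N)\right\},$$ with derivatives in the weak sense. Then every $\xi\in D^{2,2}_0(\mathbb R^N)$ is represented by exactly one function $u$, distinct elements are represented by distinct functions, and $\|\xi\|=\|\Delta u\|_{L^2(\mathbb R^N)}$ if $u$ represents $\xi$; with this identification, $$D^{2,2}_0(\mathbb R^N)=\mathcal S^2(\mathbb R^N).$$ -/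

import Mathlib

open MeasureTheory Filter Topology
open scoped ContDiff ENNReal Laplacian

noncomputable section

/-- `ℝ^N` with the Euclidean norm. -/
abbrev RN (N : ℕ) : Type := EuclideanSpace ℝ (Fin N)

/-! ### Weak derivatives, `H²_loc` and the weighted space -/

/-- `f ∈ L²_loc(ℝ^N)`. -/
def MemL2Loc {N : ℕ} {F : Type*} [NormedAddCommGroup F] (f : RN N → F) : Prop :=
  ∀ K : Set (RN N), IsCompact K → MemLp f 2 (volume.restrict K)

/-- `G` is the weak (distributional) gradient of `u`. -/
structure IsWeakGradient {N : ℕ} (u : RN N → ℝ) (G : RN N → RN N) : Prop where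
  locallyIntegrable : LocallyIntegrable u volume
  locallyIntegrable_grad : LocallyIntegrable G volume
  integral_eq : ∀ φ : RN N → ℝ, ContDiff ℝ ∞ φ → HasCompactSupport φ → ∀ i : Fin N,
    ∫ x, u x * fderiv ℝ φ x (EuclideanSpace.single i 1) = -∫ x, G x i * φ x

/-- `u ∈ H²_loc(ℝ^N)`, with weak gradient `G = ∇u` and with `H i = ∇(∂ᵢu)` as the rows of the
weak Hessian. -/
structure HasH2LocDerivs {N : ℕ} (u : RN N → ℝ) (G : RN N → RN N)
    (H : Fin N → RN N → RN N) : Prop where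
  memL2Loc : MemL2Loc u
  memL2Loc_grad : MemL2Loc G
  memL2Loc_hess : ∀ i, MemL2Loc (H i)
  weakGradient : IsWeakGradient u G
  weakHessian : ∀ i, IsWeakGradient (fun x => G x i) (H i)

/-- The Laplacian, as the trace of the Hessian whose rows are `H i`. -/
def hessTrace {N : ℕ} (H : Fin N → RN N → RN N) (x : RN N) : ℝ := ∑ i, H i x i

/-- The space `𝒮²(ℝ^N)` of (classes modulo a.e. equality of) functions `u ∈ H²_loc(ℝ^N)` such that
`Δu`, `∇u / |x|` and `u / |x|²` lie in `L²(ℝ^N)`. -/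
def SSpace (N : ℕ) : Set (RN N →ₘ[volume] ℝ) :=
  {u | ∃ (G : RN N → RN N) (H : Fin N → RN N → RN N), HasH2LocDerivs u G H ∧
    MemLp (hessTrace H) 2 volume ∧
    MemLp (fun x => ‖x‖⁻¹ • G x) 2 volume ∧
    MemLp (fun x => u x / ‖x‖ ^ 2) 2 volume}

/-! ### The homogeneous Sobolev space -/

/-- `C_0^∞(ℝ^N)` as a linear space of functions. -/
def testSubmodule (N : ℕ) : Submodule ℝ (RN N → ℝ) where
  carrier := {φ | ContDiff ℝ ∞ φ ∧ HasCompactSupport φ}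
  add_mem' h₁ h₂ := ⟨h₁.1.add h₂.1, h₁.2.add h₂.2⟩
  zero_mem' := ⟨contDiff_const, HasCompactSupport.zero⟩
  smul_mem' _ _ h := ⟨contDiff_const.smul h.1, h.2.smul_left⟩

/-- `C_0^∞(ℝ^N)`, as a type that will carry the norm `‖Δφ‖₂`. -/
def TestSpace (N : ℕ) : Type := testSubmodule N

instance (N : ℕ) : AddCommGroup (TestSpace N) := inferInstanceAs (AddCommGroup (testSubmodule N))

instance (N : ℕ) : Module ℝ (TestSpace N) := inferInstanceAs (Module ℝ (testSubmodule N))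

instance (N : ℕ) : CoeFun (TestSpace N) (fun _ => RN N → ℝ) := ⟨fun φ => φ.1⟩

theorem TestSpace.contDiff {N : ℕ} (φ : TestSpace N) : ContDiff ℝ ∞ (φ : RN N → ℝ) := φ.2.1

theorem TestSpace.contDiff_two {N : ℕ} (φ : TestSpace N) : ContDiff ℝ 2 (φ : RN N → ℝ) :=
  contDiff_infty.1 φ.2.1 2

theorem TestSpace.hasCompactSupport {N : ℕ} (φ : TestSpace N) :
    HasCompactSupport (φ : RN N → ℝ) := φ.2.2

theorem TestSpace.memLp_laplacian {N : ℕ} (φ : TestSpace N) :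
    MemLp (Δ (φ : RN N → ℝ)) 2 volume := by
  have hc : Continuous (Δ (φ : RN N → ℝ)) := by
    rw [InnerProductSpace.laplacian_eq_iteratedFDeriv_stdOrthonormalBasis]
    refine continuous_finsetSum _ fun i _ => ?_
    have := φ.contDiff_two.continuous_iteratedFDeriv (m := 2) le_rfl
    fun_prop
  refine hc.memLp_of_hasCompactSupport (φ.hasCompactSupport.mono' fun x hx => ?_)
  by_contra hx'
  apply hx
  rw [InnerProductSpace.laplacian_eq_iteratedFDeriv_stdOrthonormalBasis]
  have h0 : iteratedFDeriv ℝ 2 (φ : RN N → ℝ) x = 0 := by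
    by_contra h
    exact hx' (support_iteratedFDeriv_subset 2 h)
  simp [h0]

/-- The map `φ ↦ Δφ` from `C_0^∞(ℝ^N)` to `L²(ℝ^N)`. -/
def laplacianToLp (N : ℕ) : TestSpace N →ₗ[ℝ] Lp ℝ 2 (volume : Measure (RN N)) where
  toFun φ := φ.memLp_laplacian.toLp
  map_add' φ ψ := by
    rw [← MemLp.toLp_add]
    congr 1
    funext x
    exact φ.contDiff_two.contDiffAt.laplacian_add
      ψ.contDiff_two.contDiffAt
  map_smul' c φ := by
    rw [RingHom.id_apply, ← MemLp.toLp_const_smul]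
    congr 1
    funext x
    exact InnerProductSpace.laplacian_smul c
      φ.contDiff_two.contDiffAt

/-- `C_0^∞(ℝ^N)` is normed by `‖φ‖ = ‖Δφ‖₂`. -/
instance (N : ℕ) : SeminormedAddCommGroup (TestSpace N) :=
  SeminormedAddCommGroup.induced (TestSpace N) (Lp ℝ 2 (volume : Measure (RN N)))
    (laplacianToLp N)

instance (N : ℕ) : NormedSpace ℝ (TestSpace N) :=
  NormedSpace.induced ℝ (TestSpace N) (Lp ℝ 2 (volume : Measure (RN N))) (laplacianToLp N)

theorem TestSpace.norm_eq {N : ℕ} (φ : TestSpace N) :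
    ‖φ‖ = Real.sqrt (∫ x, (Δ (φ : RN N → ℝ) x) ^ 2) := by
  have h : ‖φ‖ = ‖φ.memLp_laplacian.toLp‖ := rfl
  rw [h, Lp.norm_toLp, φ.memLp_laplacian.eLpNorm_eq_integral_rpow_norm (by simp) (by simp),
    ENNReal.toReal_ofReal (by positivity), Real.sqrt_eq_rpow]
  simp

/-- The space `D^{2,2}_0(ℝ^N)`: the completion of `C_0^∞(ℝ^N)` with respect to `‖Δφ‖₂`. -/
abbrev DCompletion (N : ℕ) : Type := UniformSpace.Completion (TestSpace N)

/-- The critical Sobolev exponent `2N / (N - 4)`, used for `N > 4`. -/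
def sobolevExponent (N : ℕ) : ℝ≥0∞ := ENNReal.ofReal (2 * (N : ℝ) / ((N : ℝ) - 4))

/-- The element `ξ` of the completion is represented by the function `u`: some sequence in
`C_0^∞(ℝ^N)` converges to `ξ` in the completion and to `u` in `L^{2N/(N-4)}(ℝ^N)`. -/
def Represents {N : ℕ} (ξ : DCompletion N) (u : RN N →ₘ[volume] ℝ) : Prop :=
  ∃ φ : ℕ → TestSpace N,
    Tendsto (fun n => (φ n : DCompletion N)) atTop (𝓝 ξ) ∧
    Tendsto (fun n => eLpNorm (fun x => (φ n : RN N → ℝ) x - u x) (sobolevExponent N) volume)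
      atTop (𝓝 0)

/-- `D^{2,2}_0(ℝ^N)` as a space of (classes modulo a.e. equality of) functions. -/
def DSpace (N : ℕ) : Set (RN N →ₘ[volume] ℝ) := {u | ∃ ξ : DCompletion N, Represents ξ u}

end

/-! On test functions, integrating by parts twice gives
$\sum_{i,j}\|\partial_i\partial_j\varphi\|_2^2=\|\Delta\varphi\|_2^2$, so the norm of the completion
controls the whole Hessian. Two Sobolev steps, $2\to 2N/(N-2)\to 2N/(N-4)$, then control
$\nabla\varphi$ and $\varphi$ in Lebesgue spaces (`exists_eLpNorm_pderiv_le`, `exists_eLpNorm_le`),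
and two Hardy steps control $\nabla\varphi/|x|$ and $\varphi/|x|^2$ in $L^2$ (`exists_hardy_grad`,
`exists_hardy`).

The inclusion of $D^{2,2}_0$ in $\mathcal S^2$ follows: along a Cauchy sequence the functions and
their derivatives converge in these spaces, weak derivatives pass to the limit, and Fatou's lemma
carries over the Hardy bounds. The Sobolev bound also passes to the limit, so the representing
function is unique; since $\|\xi\|$ is the $L^2$ norm of its distributional Laplacian, that function
determines $\xi$.

Conversely, for $u\in\mathcal S^2$ let $\chi_n$ be a cutoff at scale $n$. Then $\Delta(\chi_n
u)-\Delta u=(\chi_n-1)\Delta u+2\nabla\chi_n\cdot\nabla u+u\,\Delta\chi_n$ lives on $|x|\ge n+1$,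
and $|\nabla\chi_n|\lesssim|x|^{-1}$, $|\Delta\chi_n|\lesssim|x|^{-2}$ uniformly in $n$. The three
integrability conditions defining $\mathcal S^2$ are what makes this tend to $0$ in $L^2$
(`tendsto_cutoffLaplacian`). Mollifying $\chi_n u$ yields test functions that are Cauchy in the norm
and converge to $u$ in the sense of distributions, which identifies their Sobolev limit with $u$. -/

noncomputable section

variable {N : ℕ}

/-! ### Coordinate derivatives and test functions -/

/-- The classical partial derivative `∂ᵢ f`. -/
def pderiv {N : ℕ} (i : Fin N) (f : RN N → ℝ) : RN N → ℝ :=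
  fun x => fderiv ℝ f x (EuclideanSpace.single i 1)

/-- `f ∈ C_0^∞(ℝ^N)`. -/
def IsTestFun {N : ℕ} (f : RN N → ℝ) : Prop := ContDiff ℝ ∞ f ∧ HasCompactSupport f

theorem ContDiff.pderiv {f : RN N → ℝ} (hf : ContDiff ℝ ∞ f) (i : Fin N) :
    ContDiff ℝ ∞ (pderiv i f) :=
  (hf.fderiv_right (m := ∞) (by simp)).clm_apply contDiff_const

theorem support_pderiv_subset (f : RN N → ℝ) (i : Fin N) :
    Function.support (pderiv i f) ⊆ tsupport f := fun x hx => by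
  by_contra h
  exact hx (by simp [pderiv, fderiv_of_notMem_tsupport (𝕜 := ℝ) h])

theorem IsTestFun.pderiv {f : RN N → ℝ} (hf : IsTestFun f) (i : Fin N) :
    IsTestFun (pderiv i f) :=
  ⟨hf.1.pderiv i, hf.2.mono' (support_pderiv_subset f i)⟩

theorem IsTestFun.continuous {f : RN N → ℝ} (hf : IsTestFun f) : Continuous f := hf.1.continuous

theorem IsTestFun.memLp {f : RN N → ℝ} (hf : IsTestFun f) (p : ℝ≥0∞) : MemLp f p volume :=
  hf.continuous.memLp_of_hasCompactSupport hf.2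

theorem TestSpace.isTestFun (φ : TestSpace N) : IsTestFun (φ : RN N → ℝ) := φ.2

theorem ContDiff.differentiable_infty {f : RN N → ℝ} (hf : ContDiff ℝ ∞ f) :
    Differentiable ℝ f := hf.differentiable (by simp)

theorem pderiv_mul {f g : RN N → ℝ} (hf : ContDiff ℝ ∞ f) (hg : ContDiff ℝ ∞ g) (i : Fin N) :
    pderiv i (fun x => f x * g x) = fun x => pderiv i f x * g x + f x * pderiv i g x := by
  funext x
  simp only [pderiv]
  rw [fderiv_fun_mul (hf.differentiable_infty x) (hg.differentiable_infty x)]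
  simp
  ring

theorem pderiv_add {f g : RN N → ℝ} (hf : ContDiff ℝ ∞ f) (hg : ContDiff ℝ ∞ g) (i : Fin N) :
    pderiv i (fun x => f x + g x) = fun x => pderiv i f x + pderiv i g x := by
  funext x
  simp only [pderiv]
  rw [fderiv_fun_add (hf.differentiable_infty x) (hg.differentiable_infty x)]
  simp

theorem pderiv_pderiv_eq {f : RN N → ℝ} (hf : ContDiff ℝ ∞ f) (i j : Fin N) (x : RN N) :
    pderiv i (pderiv j f) x =
      iteratedFDeriv ℝ 2 f x ![EuclideanSpace.single i 1, EuclideanSpace.single j 1] := by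
  rw [iteratedFDeriv_two_apply]
  have h : DifferentiableAt ℝ (fderiv ℝ f) x :=
    ((hf.fderiv_right (m := ∞) (by simp)).differentiable (by simp)) x
  have h' : pderiv j f = fun y => fderiv ℝ f y (EuclideanSpace.single j 1) := rfl
  rw [h', pderiv, fderiv_clm_apply h (by fun_prop)]
  simp

theorem pderiv_comm {f : RN N → ℝ} (hf : ContDiff ℝ ∞ f) (i j : Fin N) :
    pderiv i (pderiv j f) = pderiv j (pderiv i f) := by
  funext x
  rw [pderiv_pderiv_eq hf, pderiv_pderiv_eq hf, iteratedFDeriv_two_apply, iteratedFDeriv_two_apply]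
  have : IsSymmSndFDerivAt ℝ f x := (contDiff_infty.1 hf 2).contDiffAt.isSymmSndFDerivAt (by simp)
  simpa using this _ _

theorem laplacian_eq_sum_pderiv {f : RN N → ℝ} (hf : ContDiff ℝ ∞ f) :
    Δ f = fun x => ∑ i, pderiv i (pderiv i f) x := by
  rw [InnerProductSpace.laplacian_eq_iteratedFDeriv_orthonormalBasis f
    (EuclideanSpace.basisFun (Fin N) ℝ)]
  funext x
  simp [pderiv_pderiv_eq hf]

theorem IsTestFun.sum {ι : Type*} {f : ι → RN N → ℝ} (hf : ∀ i, IsTestFun (f i))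
    (s : Finset ι) : IsTestFun (fun x => ∑ i ∈ s, f i x) := by
  refine ⟨ContDiff.sum fun i _ => (hf i).1, ?_⟩
  induction s using Finset.cons_induction with
  | empty =>
    simp only [Finset.sum_empty]
    exact HasCompactSupport.zero
  | cons a s ha ih =>
    simp only [Finset.sum_cons]
    exact (hf a).2.add ih

theorem IsTestFun.laplacian {f : RN N → ℝ} (hf : IsTestFun f) : IsTestFun (Δ f) := by
  rw [laplacian_eq_sum_pderiv hf.1]
  exact IsTestFun.sum (fun i => (hf.pderiv i).pderiv i) _

theorem integrable_mul_of_hasCompactSupport {f g : RN N → ℝ} (hf : Continuous f)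
    (hg : Continuous g) (hgc : HasCompactSupport g) : Integrable (fun x => f x * g x) :=
  (hf.mul hg).integrable_of_hasCompactSupport hgc.mul_left

theorem integral_mul_pderiv {f g : RN N → ℝ} (hf : ContDiff ℝ ∞ f) (hg : IsTestFun g)
    (i : Fin N) : ∫ x, f x * pderiv i g x = -∫ x, pderiv i f x * g x := by
  refine integral_mul_fderiv_eq_neg_fderiv_mul_of_integrable ?_ ?_ ?_
    (fun x _ => hf.differentiable_infty x) (fun x _ => hg.1.differentiable_infty x)
  · exact integrable_mul_of_hasCompactSupport (hf.pderiv i).continuous hg.continuous hg.2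
  · exact integrable_mul_of_hasCompactSupport hf.continuous (hg.pderiv i).continuous (hg.pderiv i).2
  · exact integrable_mul_of_hasCompactSupport hf.continuous hg.continuous hg.2

theorem integral_mul_pderiv_pderiv {f g : RN N → ℝ} (hf : ContDiff ℝ ∞ f) (hg : IsTestFun g)
    (i j : Fin N) :
    ∫ x, f x * pderiv i (pderiv j g) x = ∫ x, pderiv j (pderiv i f) x * g x := by
  rw [integral_mul_pderiv hf (hg.pderiv j), integral_mul_pderiv (hf.pderiv i) hg, neg_neg]

theorem integral_mul_laplacian {f g : RN N → ℝ} (hf : ContDiff ℝ ∞ f) (hg : IsTestFun g) :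
    ∫ x, f x * Δ g x = ∫ x, Δ f x * g x := by
  simp only [laplacian_eq_sum_pderiv hf, laplacian_eq_sum_pderiv hg.1, Finset.mul_sum,
    Finset.sum_mul]
  rw [integral_finsetSum, integral_finsetSum]
  · exact Finset.sum_congr rfl fun i _ => integral_mul_pderiv_pderiv hf hg i i
  · exact fun i _ => integrable_mul_of_hasCompactSupport ((hf.pderiv i).pderiv i).continuous
      hg.continuous hg.2
  · exact fun i _ => integrable_mul_of_hasCompactSupport hf.continuous
      ((hg.pderiv i).pderiv i).continuous ((hg.pderiv i).pderiv i).2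

/-- `∑ᵢⱼ ‖∂ᵢ∂ⱼφ‖₂² = ‖Δφ‖₂²`. -/
theorem sum_integral_pderiv_pderiv_sq {f : RN N → ℝ} (hf : IsTestFun f) :
    ∑ i, ∑ j, ∫ x, pderiv i (pderiv j f) x ^ 2 = ∫ x, Δ f x ^ 2 := by
  -- Two integrations by parts, whose signs cancel, together with the symmetry of derivatives, turn
  -- each square into a product of pure second derivatives. These products sum to the square of the
  -- Laplacian.
  have h1 : ∀ i j, ∫ x, pderiv i (pderiv j f) x ^ 2 =
      ∫ x, pderiv i (pderiv i f) x * pderiv j (pderiv j f) x := by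
    intro i j
    have hij := (hf.pderiv j).pderiv i
    simp only [pow_two]
    rw [integral_mul_pderiv hij.1 (hf.pderiv j), integral_mul_pderiv ((hf.pderiv i).pderiv i).1
      (hf.pderiv j)]
    congr 1
    refine integral_congr_ae (.of_forall fun x => ?_)
    simp only
    rw [pderiv_comm hf.1 i j, pderiv_comm (hf.pderiv i).1 i j]
  simp only [h1]
  simp only [laplacian_eq_sum_pderiv hf.1, pow_two, Finset.sum_mul_sum]
  rw [integral_finsetSum]
  · refine Finset.sum_congr rfl fun i _ => ?_
    rw [integral_finsetSum]
    exact fun j _ => integrable_mul_of_hasCompactSupport ((hf.pderiv i).pderiv i).continuous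
      ((hf.pderiv j).pderiv j).continuous ((hf.pderiv j).pderiv j).2
  · exact fun i _ => integrable_finsetSum _ fun j _ => integrable_mul_of_hasCompactSupport
      ((hf.pderiv i).pderiv i).continuous
      ((hf.pderiv j).pderiv j).continuous ((hf.pderiv j).pderiv j).2

theorem eLpNorm_two_eq_ofReal_sqrt {f : RN N → ℝ} (hf : MemLp f 2 volume) :
    eLpNorm f 2 volume = ENNReal.ofReal (Real.sqrt (∫ x, f x ^ 2)) := by
  rw [hf.eLpNorm_eq_integral_rpow_norm (by simp) (by simp), Real.sqrt_eq_rpow]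
  simp

theorem TestSpace.eLpNorm_laplacian (φ : TestSpace N) :
    eLpNorm (Δ (φ : RN N → ℝ)) 2 volume = ENNReal.ofReal ‖φ‖ := by
  rw [φ.norm_eq, eLpNorm_two_eq_ofReal_sqrt φ.memLp_laplacian]

theorem eLpNorm_pderiv_pderiv_le {f : RN N → ℝ} (hf : IsTestFun f) (i j : Fin N) :
    eLpNorm (pderiv i (pderiv j f)) 2 volume ≤ eLpNorm (Δ f) 2 volume := by
  rw [eLpNorm_two_eq_ofReal_sqrt (((hf.pderiv j).pderiv i).memLp 2),
    eLpNorm_two_eq_ofReal_sqrt (hf.laplacian.memLp 2), ← sum_integral_pderiv_pderiv_sq hf]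
  gcongr
  refine le_trans ?_ (Finset.single_le_sum (f := fun i => ∑ j, ∫ x, pderiv i (pderiv j f) x ^ 2)
    (fun i _ => Finset.sum_nonneg fun j _ => integral_nonneg fun x => sq_nonneg _)
    (Finset.mem_univ i))
  exact Finset.single_le_sum (f := fun j => ∫ x, pderiv i (pderiv j f) x ^ 2)
    (fun j _ => integral_nonneg fun x => sq_nonneg _) (Finset.mem_univ j)

/-! ### Sobolev inequalities -/

/-- The Gagliardo–Nirenberg–Sobolev inequality bounds a function by the operator norm of its
derivative, while all other estimates here are coordinatewise; this is the bridge. -/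
theorem norm_fderiv_le_sum_pderiv (f : RN N → ℝ) (x : RN N) :
    ‖fderiv ℝ f x‖ ≤ ∑ i, |pderiv i f x| := by
  refine ContinuousLinearMap.opNorm_le_bound _ (Finset.sum_nonneg fun _ _ => abs_nonneg _) ?_
  intro v
  have hv : v = ∑ i, v i • EuclideanSpace.single i (1 : ℝ) := by
    simpa using ((EuclideanSpace.basisFun (Fin N) ℝ).sum_repr v).symm
  conv_lhs => rw [hv]
  rw [map_sum, Finset.sum_mul]
  refine (norm_sum_le _ _).trans (Finset.sum_le_sum fun i _ => ?_)
  rw [map_smul, norm_smul, mul_comm]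
  exact mul_le_mul_of_nonneg_left (PiLp.norm_apply_le v i) (abs_nonneg _)

theorem eLpNorm_fderiv_le_sum_pderiv {f : RN N → ℝ} (hf : IsTestFun f) {p : ℝ≥0∞} (hp : 1 ≤ p) :
    eLpNorm (fderiv ℝ f) p volume ≤ ∑ i, eLpNorm (pderiv i f) p volume := by
  calc eLpNorm (fderiv ℝ f) p volume
      ≤ eLpNorm (∑ i, fun x => |pderiv i f x|) p volume := by
        refine eLpNorm_mono_real fun x => ?_
        simpa using norm_fderiv_le_sum_pderiv f x
    _ ≤ ∑ i, eLpNorm (fun x => |pderiv i f x|) p volume :=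
        eLpNorm_sum_le (fun i _ => (hf.pderiv i).continuous.abs.aestronglyMeasurable) hp
    _ = _ := Finset.sum_congr rfl fun i _ => eLpNorm_norm (pderiv i f)

theorem exists_eLpNorm_le_sum_pderiv (hN : 0 < N) {p p' : NNReal} (hp : 1 ≤ p)
    (hp' : (p' : ℝ)⁻¹ = (p : ℝ)⁻¹ - (N : ℝ)⁻¹) :
    ∃ C : NNReal, ∀ f : RN N → ℝ, IsTestFun f →
      eLpNorm f p' volume ≤ C * ∑ i, eLpNorm (pderiv i f) p volume := by
  refine ⟨SNormLESNormFDerivOfEqConst ℝ (volume : Measure (RN N)) p, fun f hf => ?_⟩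
  refine (eLpNorm_le_eLpNorm_fderiv_of_eq volume (contDiff_infty.1 hf.1 1) hf.2 hp (by simpa)
    (by simpa using hp')).trans ?_
  gcongr
  exact eLpNorm_fderiv_le_sum_pderiv hf (by exact_mod_cast hp)

/-- The Sobolev exponent `2N / (N - 2)` of the gradient. -/
def gradSobolevExponent (N : ℕ) : ℝ≥0∞ := ENNReal.ofReal (2 * (N : ℝ) / ((N : ℝ) - 2))

theorem two_le_gradSobolevExponent (hN : 4 < N) : 2 ≤ gradSobolevExponent N := by
  have : (4 : ℝ) < N := by exact_mod_cast hN
  rw [gradSobolevExponent, ← ENNReal.ofReal_ofNat]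
  refine ENNReal.ofReal_le_ofReal ?_
  rw [le_div_iff₀ (by linarith)]
  linarith

theorem two_le_sobolevExponent (hN : 4 < N) : 2 ≤ sobolevExponent N := by
  have : (4 : ℝ) < N := by exact_mod_cast hN
  rw [sobolevExponent, ← ENNReal.ofReal_ofNat]
  refine ENNReal.ofReal_le_ofReal ?_
  rw [le_div_iff₀ (by linarith)]
  linarith

/-- Sobolev step from exponent $2$, applied to $\partial_i f$: its gradient consists of Hessian
entries, each bounded by $\|\Delta f\|_2$. The factor $N$ counts the summands. -/
theorem exists_eLpNorm_pderiv_le (hN : 4 < N) :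
    ∃ C : NNReal, ∀ f : RN N → ℝ, IsTestFun f → ∀ i,
      eLpNorm (pderiv i f) (gradSobolevExponent N) volume ≤ C * eLpNorm (Δ f) 2 volume := by
  have hN' : (4 : ℝ) < N := by exact_mod_cast hN
  obtain ⟨C, hC⟩ := exists_eLpNorm_le_sum_pderiv (N := N) (by omega) (p := 2)
    (p' := Real.toNNReal (2 * N / (N - 2))) (by norm_num) (by
      rw [Real.coe_toNNReal _ (div_nonneg (by linarith) (by linarith))]
      have h2 : (N : ℝ) - 2 ≠ 0 := by linarith
      have h0 : (N : ℝ) ≠ 0 := by linarith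
      push_cast
      field_simp)
  refine ⟨C * N, fun f hf i => (hC _ (hf.pderiv i)).trans ?_⟩
  rw [ENNReal.coe_mul, mul_assoc]
  gcongr
  refine (Finset.sum_le_sum fun j _ => eLpNorm_pderiv_pderiv_le hf j i).trans ?_
  simp

/-- Second Sobolev step, from $2N/(N-2)$ to $2N/(N-4)$, fed by the gradient bound. -/
theorem exists_eLpNorm_le (hN : 4 < N) :
    ∃ C : NNReal, ∀ f : RN N → ℝ, IsTestFun f →
      eLpNorm f (sobolevExponent N) volume ≤ C * eLpNorm (Δ f) 2 volume := by
  have hN' : (4 : ℝ) < N := by exact_mod_cast hN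
  obtain ⟨C₁, hC₁⟩ := exists_eLpNorm_pderiv_le hN
  obtain ⟨C, hC⟩ := exists_eLpNorm_le_sum_pderiv (N := N) (by omega)
    (p := Real.toNNReal (2 * N / (N - 2)))
    (p' := Real.toNNReal (2 * N / (N - 4))) (by
      have := two_le_gradSobolevExponent hN
      have h : (1 : ℝ≥0∞) ≤ gradSobolevExponent N := le_trans (by norm_num) this
      rwa [gradSobolevExponent, ENNReal.ofReal, ENNReal.one_le_coe_iff] at h) (by
      rw [Real.coe_toNNReal _ (div_nonneg (by linarith) (by linarith)),
        Real.coe_toNNReal _ (div_nonneg (by linarith) (by linarith))]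
      have h2 : (N : ℝ) - 2 ≠ 0 := by linarith
      have h4 : (N : ℝ) - 4 ≠ 0 := by linarith
      have h0 : (N : ℝ) ≠ 0 := by linarith
      field_simp
      ring)
  refine ⟨C * N * C₁, fun f hf => (hC _ hf).trans ?_⟩
  rw [ENNReal.coe_mul, ENNReal.coe_mul, mul_assoc, mul_assoc]
  gcongr
  refine (Finset.sum_le_sum fun j _ => hC₁ f hf j).trans ?_
  simp

/-! ### Hardy inequalities -/

theorem IsTestFun.mul_left {f g : RN N → ℝ} (hf : ContDiff ℝ ∞ f) (hg : IsTestFun g) :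
    IsTestFun (fun x => f x * g x) := ⟨hf.mul hg.1, hg.2.mul_left⟩

theorem IsTestFun.sq {f : RN N → ℝ} (hf : IsTestFun f) : IsTestFun (fun x => f x ^ 2) := by
  simp only [pow_two]
  exact hf.mul_left hf.1

theorem IsTestFun.integrable {f : RN N → ℝ} (hf : IsTestFun f) : Integrable f :=
  hf.continuous.integrable_of_hasCompactSupport hf.2

/-- The regularization `(|x|² + ε)⁻¹` of the Hardy weight `|x|⁻²`. -/
def hardyWeight (N : ℕ) (ε : ℝ) (x : RN N) : ℝ := (‖x‖ ^ 2 + ε)⁻¹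

theorem hardyWeight_nonneg {ε : ℝ} (hε : 0 < ε) (x : RN N) : 0 ≤ hardyWeight N ε x := by
  unfold hardyWeight; positivity

theorem contDiff_hardyWeight {ε : ℝ} (hε : 0 < ε) : ContDiff ℝ ∞ (hardyWeight N ε) :=
  ((contDiff_norm_sq ℝ).add contDiff_const).inv fun x => by positivity

theorem contDiff_coord (i : Fin N) : ContDiff ℝ ∞ (fun x : RN N => x i) := by fun_prop

theorem pderiv_coord (i : Fin N) (x : RN N) : pderiv i (fun x : RN N => x i) x = 1 := by
  have h : HasFDerivAt (fun x : RN N => x i) (EuclideanSpace.proj i : RN N →L[ℝ] ℝ) x :=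
    (EuclideanSpace.proj i : RN N →L[ℝ] ℝ).hasFDerivAt
  rw [pderiv, h.fderiv]
  simp

theorem pderiv_hardyWeight_pow {ε : ℝ} (hε : 0 < ε) (m : ℕ) (i : Fin N) (x : RN N) :
    pderiv i (fun x => hardyWeight N ε x ^ (m + 1)) x =
      -(2 * (m + 1) * x i * hardyWeight N ε x ^ (m + 2)) := by
  have h0 : ‖x‖ ^ 2 + ε ≠ 0 := by positivity
  have h1 : HasDerivAt (fun t : ℝ => ((t + ε)⁻¹) ^ (m + 1))
      (-((m + 1) * ((‖x‖ ^ 2 + ε)⁻¹) ^ (m + 2))) (‖x‖ ^ 2) := by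
    convert! (((hasDerivAt_id (‖x‖ ^ 2)).add_const ε).inv h0).pow (m + 1) using 1
    simp
    field_simp
    ring
  have h2 := h1.comp_hasFDerivAt x (hasStrictFDerivAt_norm_sq x).hasFDerivAt
  have h3 : (fun x => hardyWeight N ε x ^ (m + 1)) =
      (fun t : ℝ => ((t + ε)⁻¹) ^ (m + 1)) ∘ (fun x : RN N => ‖x‖ ^ 2) := rfl
  rw [h3, pderiv, h2.fderiv]
  simp [hardyWeight, EuclideanSpace.inner_single_right]
  ring

/-- Hardy's inequality for the weight `(|x|² + ε)⁻¹`. -/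
theorem hardy_regularized {ε : ℝ} (hε : 0 < ε) (m : ℕ) (hm : 2 * (m + 1) < N) {f : RN N → ℝ}
    (hf : IsTestFun f) :
    ((N : ℝ) - 2 * (m + 1)) ^ 2 / 4 * ∫ x, f x ^ 2 * hardyWeight N ε x ^ (m + 1) ≤
      ∑ i, ∫ x, pderiv i f x ^ 2 * hardyWeight N ε x ^ m := by
  -- For the field $V=x\,w^{m+1}$ one has $\operatorname{div}V=Nw^{m+1}-2(m+1)|x|^2w^{m+2}\ge
  -- a\,w^{m+1}$, because $|x|^2w\le 1$.
  set a : ℝ := (N : ℝ) - 2 * (m + 1) with ha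
  have ha0 : 0 < a := by
    have : (2 * (m + 1 : ℕ) : ℝ) < N := by exact_mod_cast hm
    push_cast at this
    linarith
  set w := hardyWeight N ε with hw
  have hwd : ContDiff ℝ ∞ w := contDiff_hardyWeight hε
  have hVd : ∀ i : Fin N, ContDiff ℝ ∞ (fun x => x i * w x ^ (m + 1)) := fun i =>
    (contDiff_coord i).mul (hwd.pow _)
  have hV : ∀ (i : Fin N) x, pderiv i (fun x => x i * w x ^ (m + 1)) x =
      w x ^ (m + 1) - 2 * (m + 1) * x i ^ 2 * w x ^ (m + 2) := by
    intro i x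
    rw [pderiv_mul (contDiff_coord i) (hwd.pow _)]
    simp only [pderiv_coord, hw, pderiv_hardyWeight_pow hε]
    ring
  have hsq : ∀ i x, pderiv i (fun x => f x ^ 2) x = 2 * f x * pderiv i f x := by
    intro i x
    simp only [pow_two]
    rw [pderiv_mul hf.1 hf.1]
    ring
  have hA : ∀ i, Integrable (fun x => x i * w x ^ (m + 1) * pderiv i (fun x => f x ^ 2) x) :=
    fun i => ((hf.sq.pderiv i).mul_left (hVd i)).integrable
  have hB : ∀ i, Integrable (fun x => pderiv i (fun x => x i * w x ^ (m + 1)) x * f x ^ 2) :=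
    fun i => (hf.sq.mul_left ((hVd i).pderiv i)).integrable
  have hC : ∀ i, Integrable (fun x => pderiv i f x ^ 2 * w x ^ m) := fun i => by
    simpa only [mul_comm] using ((hf.pderiv i).sq.mul_left (hwd.pow m)).integrable
  have hD : Integrable (fun x => f x ^ 2 * w x ^ (m + 1)) := by
    simpa only [mul_comm] using (hf.sq.mul_left (hwd.pow (m + 1))).integrable
  have hAB : ∀ i, Integrable (fun x => x i * w x ^ (m + 1) * pderiv i (fun x => f x ^ 2) x +
      pderiv i (fun x => x i * w x ^ (m + 1)) x * f x ^ 2) := fun i => (hA i).add (hB i)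
  have hAB' := integrable_finsetSum Finset.univ fun i _ => hAB i
  have hC' := (integrable_finsetSum Finset.univ fun i _ => hC i).const_mul (2 / a)
  -- The integrand is $\operatorname{div}(f^2V)$, a divergence with compact support.
  have hzero : ∫ x, ∑ i, (x i * w x ^ (m + 1) * pderiv i (fun x => f x ^ 2) x +
      pderiv i (fun x => x i * w x ^ (m + 1)) x * f x ^ 2) = 0 := by
    rw [integral_finsetSum _ fun i _ => hAB i]
    refine Finset.sum_eq_zero fun i _ => ?_
    rw [integral_add (hA i) (hB i), integral_mul_pderiv (hVd i) hf.sq, neg_add_cancel]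
  have hpt : ∀ x, a / 2 * (f x ^ 2 * w x ^ (m + 1)) ≤
      ∑ i, (x i * w x ^ (m + 1) * pderiv i (fun x => f x ^ 2) x +
        pderiv i (fun x => x i * w x ^ (m + 1)) x * f x ^ 2) +
      2 / a * ∑ i, pderiv i f x ^ 2 * w x ^ m := by
    intro x
    have hw0 : 0 ≤ w x := hardyWeight_nonneg hε x
    have hxw : ‖x‖ ^ 2 * w x ≤ 1 := by
      have : 0 < ‖x‖ ^ 2 + ε := by positivity
      rw [hw, hardyWeight, ← div_eq_mul_inv, div_le_one this]
      linarith
    have hx : ∑ i, x i ^ 2 = ‖x‖ ^ 2 := by simp [EuclideanSpace.norm_sq_eq]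
    have h1 : ∀ i, w x ^ (m + 1) * f x ^ 2 -
        (2 * (m + 1) + a / 2) * (w x ^ (m + 2) * f x ^ 2) * x i ^ 2 ≤
        x i * w x ^ (m + 1) * pderiv i (fun x => f x ^ 2) x +
          pderiv i (fun x => x i * w x ^ (m + 1)) x * f x ^ 2 +
        2 / a * (pderiv i f x ^ 2 * w x ^ m) := by
      intro i
      rw [hV, hsq, ← sub_nonneg]
      -- Completing the square absorbs the cross term $2f\,V\cdot\nabla f$. The price is $\tfrac
      -- a2|x|^2w^{m+2}f^2\le\tfrac a2w^{m+1}f^2$, half of the gain from $\operatorname{div}V$.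
      have : 0 ≤ w x ^ m * (a / 2 * (w x * x i * f x + 2 / a * pderiv i f x) ^ 2) := by positivity
      convert! this using 1
      field_simp
      ring
    have h2 := Finset.sum_le_sum fun i (_ : i ∈ Finset.univ) => h1 i
    rw [Finset.sum_add_distrib, ← Finset.mul_sum _ _ (2 / a), Finset.sum_sub_distrib,
      ← Finset.mul_sum _ _ ((2 * (m + 1) + a / 2) * (w x ^ (m + 2) * f x ^ 2)), hx] at h2
    refine le_trans ?_ h2
    have h3 : ‖x‖ ^ 2 * w x * (w x ^ (m + 1) * f x ^ 2) ≤ 1 * (w x ^ (m + 1) * f x ^ 2) := by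
      gcongr
    have h4 : (2 * (m + 1) + a / 2) * (‖x‖ ^ 2 * w x * (w x ^ (m + 1) * f x ^ 2)) ≤
        (2 * (m + 1) + a / 2) * (1 * (w x ^ (m + 1) * f x ^ 2)) := by gcongr
    simp only [Finset.sum_const, Finset.card_univ, Fintype.card_fin, nsmul_eq_mul]
    have hNa : (N : ℝ) = a + 2 * (m + 1) := by rw [ha]; ring
    rw [hNa]
    have : w x ^ (m + 2) = w x * w x ^ (m + 1) := by ring
    rw [this]
    linarith
  have hint := integral_mono (hD.const_mul (a / 2))
    (hAB'.add hC') hpt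
  rw [integral_const_mul] at hint
  simp only [Pi.add_apply] at hint
  rw [integral_add hAB' hC', hzero, zero_add, integral_const_mul,
    integral_finsetSum _ fun i _ => hC i] at hint
  have := mul_le_mul_of_nonneg_left hint (by positivity : 0 ≤ a / 2)
  calc _ = a / 2 * (a / 2 * ∫ x, f x ^ 2 * w x ^ (m + 1)) := by ring
    _ ≤ _ := this
    _ = _ := by field_simp

/-- The case $m=0$ of `hardy_regularized` for each $\partial_i f$, summed by the Hessian identity.
The constant is independent of $\varepsilon$, so that $\varepsilon\to0$ is possible later. -/
theorem exists_hardy_grad (hN : 4 < N) : ∃ C : ℝ, 0 ≤ C ∧ ∀ f : RN N → ℝ, IsTestFun f →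
    ∀ ε : ℝ, 0 < ε → ∑ i, ∫ x, pderiv i f x ^ 2 * hardyWeight N ε x ≤ C * ∫ x, Δ f x ^ 2 := by
  have hN' : (4 : ℝ) < N := by exact_mod_cast hN
  have ha : 0 < ((N : ℝ) - 2) ^ 2 / 4 := by
    have : 0 < (N : ℝ) - 2 := by linarith
    positivity
  refine ⟨(((N : ℝ) - 2) ^ 2 / 4)⁻¹, by positivity, fun f hf ε hε => ?_⟩
  rw [← div_eq_inv_mul, le_div_iff₀' ha, ← sum_integral_pderiv_pderiv_sq hf, Finset.mul_sum,
    Finset.sum_comm]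
  refine Finset.sum_le_sum fun i _ => ?_
  simpa using hardy_regularized hε 0 (by omega) (hf.pderiv i)

/-- The case $m=1$ followed by the gradient bound; the constant $(N-4)^2/4$ comes from $m=1$, which
requires $N>4$. -/
theorem exists_hardy (hN : 4 < N) : ∃ C : ℝ, 0 ≤ C ∧ ∀ f : RN N → ℝ, IsTestFun f →
    ∀ ε : ℝ, 0 < ε → ∫ x, f x ^ 2 * hardyWeight N ε x ^ 2 ≤ C * ∫ x, Δ f x ^ 2 := by
  have hN' : (4 : ℝ) < N := by exact_mod_cast hN
  obtain ⟨C, hC0, hC⟩ := exists_hardy_grad hN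
  have ha : 0 < ((N : ℝ) - 4) ^ 2 / 4 := by
    have : 0 < (N : ℝ) - 4 := by linarith
    positivity
  refine ⟨(((N : ℝ) - 4) ^ 2 / 4)⁻¹ * C, by positivity, fun f hf ε hε => ?_⟩
  rw [mul_assoc, ← div_eq_inv_mul, le_div_iff₀' ha]
  refine le_trans ?_ (hC f hf ε hε)
  have := hardy_regularized hε 1 (by omega) hf
  norm_num at this
  exact this

/-- `‖f (|x|² + ε)⁻¹‖₂ ≤ C ‖Δf‖₂`. -/
theorem exists_eLpNorm_mul_hardyWeight_le (hN : 4 < N) : ∃ C : NNReal, ∀ f : RN N → ℝ,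
    IsTestFun f → ∀ ε : ℝ, 0 < ε →
      eLpNorm (fun x => f x * hardyWeight N ε x) 2 volume ≤ C * eLpNorm (Δ f) 2 volume := by
  obtain ⟨C, hC0, hC⟩ := exists_hardy hN
  refine ⟨(Real.sqrt C).toNNReal, fun f hf ε hε => ?_⟩
  have ht : IsTestFun (fun x => f x * hardyWeight N ε x) := by
    simpa only [mul_comm] using hf.mul_left (contDiff_hardyWeight hε)
  rw [eLpNorm_two_eq_ofReal_sqrt (ht.memLp 2), eLpNorm_two_eq_ofReal_sqrt (hf.laplacian.memLp 2),
    ← ENNReal.ofReal, ← ENNReal.ofReal_mul (by positivity), ← Real.sqrt_mul hC0]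
  refine ENNReal.ofReal_le_ofReal (Real.sqrt_le_sqrt ?_)
  simpa only [mul_pow] using hC f hf ε hε

/-- `‖∂ᵢf (|x|² + ε)^{-1/2}‖₂ ≤ C ‖Δf‖₂`. -/
theorem exists_eLpNorm_pderiv_mul_sqrt_hardyWeight_le (hN : 4 < N) : ∃ C : NNReal,
    ∀ f : RN N → ℝ, IsTestFun f → ∀ i, ∀ ε : ℝ, 0 < ε →
      eLpNorm (fun x => pderiv i f x * Real.sqrt (hardyWeight N ε x)) 2 volume ≤
        C * eLpNorm (Δ f) 2 volume := by
  obtain ⟨C, hC0, hC⟩ := exists_hardy_grad hN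
  refine ⟨(Real.sqrt C).toNNReal, fun f hf i ε hε => ?_⟩
  have ht : MemLp (fun x => pderiv i f x * Real.sqrt (hardyWeight N ε x)) 2 volume :=
    ((hf.pderiv i).continuous.mul
      (contDiff_hardyWeight hε).continuous.sqrt).memLp_of_hasCompactSupport (hf.pderiv i).2.mul_right
  rw [eLpNorm_two_eq_ofReal_sqrt ht, eLpNorm_two_eq_ofReal_sqrt (hf.laplacian.memLp 2),
    ← ENNReal.ofReal, ← ENNReal.ofReal_mul (by positivity), ← Real.sqrt_mul hC0]
  refine ENNReal.ofReal_le_ofReal (Real.sqrt_le_sqrt ?_)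
  simp only [mul_pow, Real.sq_sqrt (hardyWeight_nonneg hε _)]
  refine le_trans ?_ (hC f hf ε hε)
  exact Finset.single_le_sum (f := fun i => ∫ x, pderiv i f x ^ 2 * hardyWeight N ε x)
    (fun i _ => integral_nonneg fun x => mul_nonneg (sq_nonneg _) (hardyWeight_nonneg hε x))
    (Finset.mem_univ i)

/-! ### Limits of test functions -/

/-- Hölder's inequality with the conjugate exponent. This is how every distributional identity below
passes to the limit. -/
theorem tendsto_integral_mul_of_tendsto_eLpNorm {p : ℝ≥0∞} (hp : 1 ≤ p) {f : ℕ → RN N → ℝ}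
    {g : RN N → ℝ} (hf : ∀ n, MemLp (f n) p volume) (hg : MemLp g p volume)
    (h : Tendsto (fun n => eLpNorm (fun x => f n x - g x) p volume) atTop (𝓝 0))
    {η : RN N → ℝ} (hη : IsTestFun η) :
    Tendsto (fun n => ∫ x, f n x * η x) atTop (𝓝 (∫ x, g x * η x)) := by
  have := ENNReal.HolderConjugate.conjExponent hp
  set q := ENNReal.conjExponent p
  refine tendsto_integral_of_L1' (fun x => g x * η x) (hg.integrable_mul (hη.memLp q)).1
    (.of_forall fun n => (hf n).integrable_mul (hη.memLp q)) ?_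
  have hlim : Tendsto (fun n => eLpNorm (fun x => f n x - g x) p volume * eLpNorm η q volume)
      atTop (𝓝 0) := by
    simpa using ENNReal.Tendsto.mul_const h (Or.inr (hη.memLp q).eLpNorm_ne_top)
  refine tendsto_of_tendsto_of_tendsto_of_le_of_le tendsto_const_nhds hlim (fun _ => zero_le) ?_
  intro n
  have h1 := eLpNorm_smul_le_mul_eLpNorm (p := p) (q := q) (r := 1) (hη.memLp q).1
    ((hf n).1.sub hg.1)
  refine le_trans (le_of_eq (congrArg (fun F => eLpNorm F 1 volume) ?_)) h1
  funext x
  simp [sub_mul]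

/-- Two locally integrable functions that agree against test functions agree a.e. -/
theorem ae_eq_of_integral_mul_eq {f g : RN N → ℝ} (hf : LocallyIntegrable f)
    (hg : LocallyIntegrable g)
    (h : ∀ η, IsTestFun η → ∫ x, f x * η x = ∫ x, g x * η x) : f =ᵐ[volume] g :=
  ae_eq_of_integral_contDiff_smul_eq hf hg fun η h1 h2 => by
    simpa only [smul_eq_mul, mul_comm] using h η ⟨h1, h2⟩

theorem memLp_of_tendsto_eLpNorm_sub {p : ℝ≥0∞} {f : ℕ → RN N → ℝ} {g : RN N → ℝ}
    (hf : ∀ n, MemLp (f n) p volume) (hg : AEStronglyMeasurable g volume)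
    (h : Tendsto (fun n => eLpNorm (fun x => f n x - g x) p volume) atTop (𝓝 0)) :
    MemLp g p volume := by
  obtain ⟨n, hn⟩ := (h.eventually_lt_const ENNReal.zero_lt_top).exists
  have h1 : MemLp (fun x => f n x - g x) p volume := ⟨(hf n).1.sub hg, hn⟩
  convert! (hf n).sub h1 using 1
  funext x
  simp

theorem TestSpace.sub_apply (φ ψ : TestSpace N) :
    ((φ - ψ : TestSpace N) : RN N → ℝ) = fun x => φ x - ψ x := rfl

theorem pderiv_sub {f g : RN N → ℝ} (hf : ContDiff ℝ ∞ f) (hg : ContDiff ℝ ∞ g) (i : Fin N) :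
    pderiv i (fun x => f x - g x) = fun x => pderiv i f x - pderiv i g x := by
  funext x
  simp only [pderiv]
  rw [fderiv_fun_sub (hf.differentiable_infty x) (hg.differentiable_infty x)]
  simp

/-- An additive operator on test functions that is bounded from `‖Δ·‖₂` to `L^p` maps Cauchy
sequences to convergent ones. -/
theorem exists_tendsto_eLpNorm_of_cauchySeq {p : ℝ≥0∞} (hp : 1 ≤ p) {φ : ℕ → TestSpace N}
    (hφ : CauchySeq φ) (T : (RN N → ℝ) → RN N → ℝ) (hT : ∀ f, IsTestFun f → IsTestFun (T f))
    (hsub : ∀ f g, IsTestFun f → IsTestFun g →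
      T (fun x => f x - g x) = fun x => T f x - T g x) {C : NNReal}
    (hC : ∀ f, IsTestFun f → eLpNorm (T f) p volume ≤ C * eLpNorm (Δ f) 2 volume) :
    ∃ g, MemLp g p volume ∧
      Tendsto (fun n => eLpNorm (fun x => T (φ n) x - g x) p volume) atTop (𝓝 0) := by
  have : Fact (1 ≤ p) := ⟨hp⟩
  set F : TestSpace N → Lp ℝ p (volume : Measure (RN N)) :=
    fun ψ => ((hT ψ ψ.isTestFun).memLp p).toLp with hF
  -- The distance on `TestSpace N` is $\|\Delta(\psi-\chi)\|_2$, so the bound on `T` is a Lipschitz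
  -- bound and Cauchy sequences are preserved.
  have hL : LipschitzWith C F := by
    intro ψ χ
    rw [hF, Lp.edist_toLp_toLp, edist_dist, dist_eq_norm, ← TestSpace.eLpNorm_laplacian]
    refine le_trans (le_of_eq ?_) (hC _ (ψ - χ).isTestFun)
    rw [TestSpace.sub_apply, hsub _ _ ψ.isTestFun χ.isTestFun]
    rfl
  obtain ⟨G, hG⟩ := cauchySeq_tendsto_of_complete (hL.uniformContinuous.comp_cauchySeq hφ)
  refine ⟨G, Lp.memLp G, ?_⟩
  rw [tendsto_iff_edist_tendsto_0] at hG
  refine hG.congr fun n => ?_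
  rw [Function.comp_apply, Lp.edist_def]
  refine eLpNorm_congr_ae ?_
  filter_upwards [MemLp.coeFn_toLp ((hT (φ n) (φ n).isTestFun).memLp p)] with x hx
  simp [hF, hx]

theorem exists_seq_tendsto_completion (ξ : DCompletion N) :
    ∃ φ : ℕ → TestSpace N, Tendsto (fun n => (φ n : DCompletion N)) atTop (𝓝 ξ) := by
  obtain ⟨x, hx, hlim⟩ := mem_closure_iff_seq_limit.1
    (UniformSpace.Completion.denseRange_coe (α := TestSpace N) ξ)
  choose φ hφ using hx
  exact ⟨φ, by simpa only [hφ] using hlim⟩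

theorem cauchySeq_of_tendsto_completion {φ : ℕ → TestSpace N} {ξ : DCompletion N}
    (h : Tendsto (fun n => (φ n : DCompletion N)) atTop (𝓝 ξ)) : CauchySeq φ :=
  (UniformSpace.Completion.isUniformInducing_coe (TestSpace N)).cauchy_map_iff.1
    (by rw [Filter.map_map]; exact h.cauchySeq)

/-- Cauchy sequences of `TestSpace N` converge in `L^{2N/(N-4)}`. -/
theorem exists_tendsto_eLpNorm_sobolev (hN : 4 < N) {φ : ℕ → TestSpace N} (hφ : CauchySeq φ) :
    ∃ u, MemLp u (sobolevExponent N) volume ∧ Tendsto (fun n =>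
      eLpNorm (fun x => (φ n : RN N → ℝ) x - u x) (sobolevExponent N) volume) atTop (𝓝 0) := by
  obtain ⟨C, hC⟩ := exists_eLpNorm_le hN
  exact exists_tendsto_eLpNorm_of_cauchySeq (le_trans (by norm_num) (two_le_sobolevExponent hN)) hφ
    id (fun _ h => h) (fun _ _ _ _ => rfl) hC

theorem exists_tendsto_eLpNorm_pderiv (hN : 4 < N) {φ : ℕ → TestSpace N} (hφ : CauchySeq φ)
    (i : Fin N) : ∃ g, MemLp g (gradSobolevExponent N) volume ∧ Tendsto (fun n =>
      eLpNorm (fun x => pderiv i (φ n) x - g x) (gradSobolevExponent N) volume) atTop (𝓝 0) := by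
  obtain ⟨C, hC⟩ := exists_eLpNorm_pderiv_le hN
  exact exists_tendsto_eLpNorm_of_cauchySeq
    (le_trans (by norm_num) (two_le_gradSobolevExponent hN)) hφ (pderiv i) (fun _ h => h.pderiv i)
    (fun _ _ hf hg => pderiv_sub hf.1 hg.1 i) (fun f hf => hC f hf i)

theorem exists_tendsto_eLpNorm_pderiv_pderiv {φ : ℕ → TestSpace N} (hφ : CauchySeq φ)
    (i j : Fin N) : ∃ g, MemLp g 2 volume ∧ Tendsto (fun n =>
      eLpNorm (fun x => pderiv i (pderiv j (φ n)) x - g x) 2 volume) atTop (𝓝 0) := by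
  refine exists_tendsto_eLpNorm_of_cauchySeq (C := 1) (by norm_num) hφ
    (fun f => pderiv i (pderiv j f)) (fun _ h => (h.pderiv j).pderiv i)
    (fun f g hf hg => ?_) (fun f hf => ?_)
  · rw [pderiv_sub hf.1 hg.1, pderiv_sub (hf.pderiv j).1 (hg.pderiv j).1]
  · simpa using eLpNorm_pderiv_pderiv_le hf i j

theorem exists_tendsto_eLpNorm_laplacian {φ : ℕ → TestSpace N} (hφ : CauchySeq φ) :
    ∃ g, MemLp g 2 volume ∧ Tendsto (fun n =>
      eLpNorm (fun x => Δ (φ n : RN N → ℝ) x - g x) 2 volume) atTop (𝓝 0) := by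
  refine exists_tendsto_eLpNorm_of_cauchySeq (C := 1) (by norm_num) hφ
    (fun f => Δ f) (fun _ h => h.laplacian) (fun f g hf hg => ?_) (fun f hf => by simp)
  funext x
  exact (contDiff_infty.1 hf.1 2).contDiffAt.laplacian_sub (contDiff_infty.1 hg.1 2).contDiffAt

/-! ### Weak derivatives of limits -/

theorem memL2Loc_of_memLp {F : Type*} [NormedAddCommGroup F] {p : ℝ≥0∞} (hp : 2 ≤ p)
    {f : RN N → F} (hf : MemLp f p volume) : MemL2Loc f := by
  intro K hK
  have : IsFiniteMeasure (volume.restrict K : Measure (RN N)) :=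
    ⟨by simpa using hK.measure_lt_top⟩
  exact (hf.restrict K).mono_exponent hp

/-- Both sides of the classical integration by parts converge. Two exponents are needed, since a
function and its gradient converge in different Sobolev spaces. -/
theorem isWeakGradient_of_tendsto {p q : ℝ≥0∞} (hp : 1 ≤ p) (hq : 1 ≤ q) {f : ℕ → RN N → ℝ}
    {u : RN N → ℝ} {g : Fin N → RN N → ℝ} (hf : ∀ n, IsTestFun (f n)) (hu : MemLp u p volume)
    (hg : ∀ i, MemLp (g i) q volume)
    (h1 : Tendsto (fun n => eLpNorm (fun x => f n x - u x) p volume) atTop (𝓝 0))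
    (h2 : ∀ i, Tendsto (fun n => eLpNorm (fun x => pderiv i (f n) x - g i x) q volume)
      atTop (𝓝 0)) :
    IsWeakGradient u (fun x => WithLp.toLp 2 fun i => g i x) where
  locallyIntegrable := hu.locallyIntegrable hp
  locallyIntegrable_grad := (MemLp.of_eval_piLp hg).locallyIntegrable hq
  integral_eq φ hφ1 hφ2 i := by
    have hφ : IsTestFun φ := ⟨hφ1, hφ2⟩
    have t1 := tendsto_integral_mul_of_tendsto_eLpNorm hp (fun n => (hf n).memLp p) hu h1
      (hφ.pderiv i)
    have t2 := (tendsto_integral_mul_of_tendsto_eLpNorm hq (fun n => ((hf n).pderiv i).memLp q)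
      (hg i) (h2 i) hφ).neg
    refine tendsto_nhds_unique t1 (t2.congr fun n => ?_)
    rw [integral_mul_pderiv (hf n).1 hφ]

/-- Fatou's lemma along an a.e. convergent subsequence. As the bound is uniform in both indices, the
functions and the weights may go to their limits together. -/
theorem memLp_mul_weight_of_tendsto {p : ℝ≥0∞} (hp : p ≠ 0) {f : ℕ → RN N → ℝ} {u : RN N → ℝ}
    (hf : ∀ n, IsTestFun (f n)) (hu : MemLp u p volume)
    (h : Tendsto (fun n => eLpNorm (fun x => f n x - u x) p volume) atTop (𝓝 0))
    {w : ℕ → RN N → ℝ} {w' : RN N → ℝ} (hwc : ∀ n, Continuous (w n))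
    (hw : ∀ᵐ x, Tendsto (fun n => w n x) atTop (𝓝 (w' x))) {B : ℝ≥0∞} (hB : B < ⊤)
    (hb : ∀ n k, eLpNorm (fun x => f n x * w k x) 2 volume ≤ B) :
    MemLp (fun x => u x * w' x) 2 volume := by
  obtain ⟨ns, -, hns⟩ := (tendstoInMeasure_of_tendsto_eLpNorm hp
    (fun n => (hf n).continuous.aestronglyMeasurable) hu.1 h).exists_seq_tendsto_ae
  have hlim : ∀ᵐ x, Tendsto (fun k => f (ns k) x * w k x) atTop (𝓝 (u x * w' x)) := by
    filter_upwards [hns, hw] with x h1 h2 using h1.mul h2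
  have hm : ∀ k, AEStronglyMeasurable (fun x => f (ns k) x * w k x) volume := fun k =>
    ((hf _).continuous.mul (hwc k)).aestronglyMeasurable
  exact ⟨aestronglyMeasurable_of_tendsto_ae atTop hm hlim,
    (Lp.eLpNorm_le_of_ae_tendsto (.of_forall fun k => hb (ns k) k) hm hlim).trans_lt hB⟩

theorem tendsto_hardyWeight {x : RN N} (hx : x ≠ 0) :
    Tendsto (fun k : ℕ => hardyWeight N (1 / ((k : ℝ) + 1)) x) atTop (𝓝 (‖x‖ ^ 2)⁻¹) := by
  have h : Tendsto (fun k : ℕ => ‖x‖ ^ 2 + 1 / ((k : ℝ) + 1)) atTop (𝓝 (‖x‖ ^ 2 + 0)) :=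
    tendsto_const_nhds.add tendsto_one_div_add_atTop_nhds_zero_nat
  rw [add_zero] at h
  exact h.inv₀ (by positivity)

theorem exists_eLpNorm_laplacian_le {φ : ℕ → TestSpace N} (hφ : CauchySeq φ) :
    ∃ B : ℝ≥0∞, B < ⊤ ∧ ∀ n, eLpNorm (Δ (φ n : RN N → ℝ)) 2 volume ≤ B := by
  obtain ⟨R, -, hR⟩ := cauchySeq_bdd hφ
  refine ⟨ENNReal.ofReal (R + ‖φ 0‖), ENNReal.ofReal_lt_top, fun n => ?_⟩
  rw [TestSpace.eLpNorm_laplacian]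
  refine ENNReal.ofReal_le_ofReal ?_
  have h1 := hR n 0
  rw [dist_eq_norm] at h1
  have h2 := norm_sub_norm_le (φ n) (φ 0)
  linarith

/-- `D^{2,2}_0 ⊆ 𝒮²`. -/
theorem Represents.mem_sSpace (hN : 4 < N) {ξ : DCompletion N} {u : RN N →ₘ[volume] ℝ}
    (h : Represents ξ u) : u ∈ SSpace N := by
  obtain ⟨φ, hφξ, hφu⟩ := h
  have hφ := cauchySeq_of_tendsto_completion hφξ
  have hp := two_le_sobolevExponent hN
  have hq := two_le_gradSobolevExponent hN
  have hp1 : 1 ≤ sobolevExponent N := le_trans (by norm_num) hp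
  have hq1 : 1 ≤ gradSobolevExponent N := le_trans (by norm_num) hq
  have hu : MemLp u (sobolevExponent N) volume :=
    memLp_of_tendsto_eLpNorm_sub (fun n => (φ n).isTestFun.memLp _) u.aestronglyMeasurable hφu
  choose g hg hφg using exists_tendsto_eLpNorm_pderiv hN hφ
  choose k hk hφk using fun i j => exists_tendsto_eLpNorm_pderiv_pderiv hφ i j
  obtain ⟨B, hB, hφB⟩ := exists_eLpNorm_laplacian_le hφ
  obtain ⟨C₁, hC₁⟩ := exists_eLpNorm_mul_hardyWeight_le hN
  obtain ⟨C₂, hC₂⟩ := exists_eLpNorm_pderiv_mul_sqrt_hardyWeight_le hN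
  have : Nonempty (Fin N) := ⟨⟨0, by omega⟩⟩
  have hne : ∀ᵐ x : RN N, x ≠ 0 := Measure.ae_ne volume 0
  have hε : ∀ k : ℕ, 0 < 1 / ((k : ℝ) + 1) := fun k => by positivity
  -- Row $i$ of the Hessian is the gradient of `g i`, and `k j i` is the limit of
  -- $\partial_j\partial_i\varphi_n$; hence the order of the indices.
  refine ⟨fun x => WithLp.toLp 2 fun i => g i x, fun i x => WithLp.toLp 2 fun j => k j i x,
    ⟨memL2Loc_of_memLp hp hu, memL2Loc_of_memLp hq (MemLp.of_eval_piLp hg),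
      fun i => memL2Loc_of_memLp le_rfl (MemLp.of_eval_piLp fun j => hk j i), ?_, fun i => ?_⟩, ?_, ?_, ?_⟩
  · exact isWeakGradient_of_tendsto hp1 hq1 (fun n => (φ n).isTestFun) hu hg hφu hφg
  · exact isWeakGradient_of_tendsto hq1 (by norm_num) (fun n => (φ n).isTestFun.pderiv i) (hg i)
      (fun j => hk j i) (hφg i) (fun j => hφk j i)
  · exact memLp_finsetSum _ fun i _ => hk i i
  · refine MemLp.of_eval_piLp fun i => ?_
    have := memLp_mul_weight_of_tendsto (p := gradSobolevExponent N) (by positivity)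
      (fun n => (φ n).isTestFun.pderiv i) (hg i) (hφg i)
      (w := fun k x => Real.sqrt (hardyWeight N (1 / ((k : ℝ) + 1)) x)) (w' := fun x => ‖x‖⁻¹)
      (fun k => (contDiff_hardyWeight (hε k)).continuous.sqrt) ?_ (B := C₂ * B)
      (ENNReal.mul_lt_top ENNReal.coe_lt_top hB) (fun n k => ?_)
    · simpa [mul_comm] using this
    · filter_upwards [hne] with x hx
      have := (Real.continuous_sqrt.tendsto _).comp (tendsto_hardyWeight hx)
      simpa [Real.sqrt_inv, Function.comp_def] using this
    · refine (hC₂ _ (φ n).isTestFun i _ (hε k)).trans ?_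
      gcongr
      exact hφB n
  · have := memLp_mul_weight_of_tendsto (p := sobolevExponent N) (by positivity)
      (fun n => (φ n).isTestFun) hu hφu
      (w := fun k x => hardyWeight N (1 / ((k : ℝ) + 1)) x) (w' := fun x => (‖x‖ ^ 2)⁻¹)
      (fun k => (contDiff_hardyWeight (hε k)).continuous) ?_ (B := C₁ * B)
      (ENNReal.mul_lt_top ENNReal.coe_lt_top hB) (fun n k => ?_)
    · simpa [div_eq_mul_inv] using this
    · filter_upwards [hne] with x hx using tendsto_hardyWeight hx
    · refine (hC₁ _ (φ n).isTestFun _ (hε k)).trans ?_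
      gcongr
      exact hφB n

/-! ### Mollification -/

/-- The convolution `ρ * g`. -/
def mollify (ρ g : RN N → ℝ) : RN N → ℝ :=
  convolution g ρ (ContinuousLinearMap.mul ℝ ℝ) volume

theorem mollify_apply (ρ g : RN N → ℝ) (x : RN N) : mollify ρ g x = ∫ t, g t * ρ (x - t) := rfl

theorem mollify_apply_swap (ρ g : RN N → ℝ) (x : RN N) :
    mollify ρ g x = ∫ s, g (x - s) * ρ s := by
  rw [mollify_apply, ← integral_sub_left_eq_self (fun t => g t * ρ (x - t)) volume x]
  simp

theorem contDiff_mollify {ρ g : RN N → ℝ} (hρ : IsTestFun ρ) (hg : LocallyIntegrable g) :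
    ContDiff ℝ ∞ (mollify ρ g) :=
  hρ.2.contDiff_convolution_right (n := ⊤) _ hg hρ.1

theorem IsTestFun.comp_sub_left {ρ : RN N → ℝ} (hρ : IsTestFun ρ) (x : RN N) :
    IsTestFun (fun t => ρ (x - t)) :=
  ⟨hρ.1.comp (contDiff_const.sub contDiff_id),
    hρ.2.comp_homeomorph (Homeomorph.subLeft x)⟩

theorem pderiv_comp_sub_left {ρ : RN N → ℝ} (hρ : IsTestFun ρ) (x : RN N) (i : Fin N) (t : RN N) :
    pderiv i (fun t => ρ (x - t)) t = -pderiv i ρ (x - t) := by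
  have h := (hρ.1.differentiable_infty (x - t)).hasFDerivAt.comp t
    ((hasFDerivAt_id (𝕜 := ℝ) t).const_sub x)
  have h' : HasFDerivAt (fun t => ρ (x - t)) _ t := h
  rw [pderiv, h'.fderiv]
  simp [pderiv]

/-- The derivative falls on $\rho$; testing the weak gradient with $t\mapsto\rho(x-t)$ moves it to
$u$. The sign of the inner derivative cancels that of the integration by parts. -/
theorem pderiv_mollify {ρ u : RN N → ℝ} {G : RN N → RN N} (hρ : IsTestFun ρ)
    (h : IsWeakGradient u G) (i : Fin N) :
    pderiv i (mollify ρ u) = mollify ρ (fun x => G x i) := by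
  funext x
  have h1 := hρ.2.hasFDerivAt_convolution_right (ContinuousLinearMap.mul ℝ ℝ)
    h.locallyIntegrable (contDiff_infty.1 hρ.1 1) x
  rw [pderiv, mollify, h1.fderiv, convolution_precompR_apply _ h.locallyIntegrable (hρ.2.fderiv ℝ)
    (hρ.1.continuous_fderiv (by simp))]
  change ∫ t, u t * pderiv i ρ (x - t) = _
  have h2 := h.integral_eq _ (hρ.comp_sub_left x).1 (hρ.comp_sub_left x).2 i
  change ∫ t, u t * pderiv i (fun t => ρ (x - t)) t = _ at h2
  simp only [pderiv_comp_sub_left hρ, mul_neg, integral_neg, neg_inj] at h2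
  rw [h2, mollify_apply]

/-- Translations are continuous in `L²`. -/
theorem exists_eLpNorm_translate_sub_le {g : RN N → ℝ} (hg : MemLp g 2 volume) {ε : ℝ≥0∞}
    (hε : 0 < ε) : ∃ δ > 0, ∀ s : RN N, ‖s‖ < δ →
      eLpNorm (fun x => g (x - s) - g x) 2 volume ≤ ε := by
  have : Fact ((2 : ℝ≥0∞) ≠ ⊤) := ⟨by simp⟩
  have hc : Continuous fun s : RN N => DomAddAct.mk (-s) +ᵥ hg.toLp := by
    have : Continuous fun s : RN N => DomAddAct.mk (-s) :=
      DomAddAct.continuous_mk.comp continuous_neg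
    fun_prop
  have h0 : DomAddAct.mk (-(0 : RN N)) +ᵥ hg.toLp = hg.toLp := by simp
  obtain ⟨δ, hδ, h⟩ := Metric.eventually_nhds_iff.1
    (hc.continuousAt.eventually (Metric.eball_mem_nhds _ hε) : ∀ᶠ s in 𝓝 (0 : RN N), _)
  refine ⟨δ, hδ, fun s hs => ?_⟩
  have h1 := h (show dist s 0 < δ by simpa using hs)
  change edist _ (DomAddAct.mk (-(0 : RN N)) +ᵥ hg.toLp) < ε at h1
  rw [h0, DomAddAct.mk_vadd_toLp, Lp.edist_toLp_toLp] at h1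
  refine le_trans (le_of_eq ?_) h1.le
  congr 1
  funext x
  simp [sub_eq_neg_add]

theorem eLpNorm_two_sq {α : Type*} [MeasurableSpace α] (μ : Measure α) (f : α → ℝ) :
    eLpNorm f 2 μ ^ 2 = ∫⁻ x, ‖f x‖ₑ ^ 2 ∂μ := by
  have := eLpNorm_nnreal_pow_eq_lintegral (f := f) (μ := μ) (p := 2) (by norm_num)
  simpa using this

/-- Jensen's inequality for the square and the probability density `ρ`. -/
theorem enorm_integral_mul_sq_le {ρ F : RN N → ℝ} (hρ : IsTestFun ρ) (h0 : ∀ x, 0 ≤ ρ x)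
    (h1 : ∫ x, ρ x = 1) (hF : StronglyMeasurable F) :
    ‖∫ s, F s * ρ s‖ₑ ^ 2 ≤ ∫⁻ s, ENNReal.ofReal (ρ s) * ‖F s‖ₑ ^ 2 := by
  have hm : Measurable fun s => ENNReal.ofReal (ρ s) := hρ.continuous.measurable.ennreal_ofReal
  set ν := (volume : Measure (RN N)).withDensity fun s => ENNReal.ofReal (ρ s) with hν
  have hp : IsProbabilityMeasure ν := ⟨by
    rw [hν, withDensity_apply _ MeasurableSet.univ, Measure.restrict_univ,
      ← ofReal_integral_eq_lintegral_ofReal hρ.integrable (.of_forall h0), h1, ENNReal.ofReal_one]⟩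
  -- On the probability space $\nu=\rho\,dx$ the $L^1$ norm is at most the $L^2$ norm.
  have h2 : ‖∫ s, F s * ρ s‖ₑ ≤ eLpNorm F 2 ν := by
    refine le_trans ?_ (eLpNorm_le_eLpNorm_of_exponent_le (p := 1) (by norm_num)
      hF.aestronglyMeasurable)
    rw [eLpNorm_one_eq_lintegral_enorm, hν,
      lintegral_withDensity_eq_lintegral_mul _ hm hF.measurable.enorm]
    refine (enorm_integral_le_lintegral_enorm _).trans (le_of_eq ?_)
    refine lintegral_congr fun s => ?_
    rw [enorm_mul, Real.enorm_eq_ofReal (h0 s), mul_comm]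
    rfl
  refine (pow_le_pow_left₀ zero_le h2 2).trans (le_of_eq ?_)
  rw [eLpNorm_two_sq, hν, lintegral_withDensity_eq_lintegral_mul _ hm
    (hF.measurable.enorm.pow_const 2)]
  rfl

theorem mollify_congr (ρ : RN N → ℝ) {g g' : RN N → ℝ} (h : g =ᵐ[volume] g') :
    mollify ρ g = mollify ρ g' := by
  funext x
  refine integral_congr_ae ?_
  filter_upwards [h] with t ht
  simp [ht]

theorem mollify_sub_eq {ρ g : RN N → ℝ} (hρ : IsTestFun ρ) (h1 : ∫ x, ρ x = 1)
    (hg : LocallyIntegrable g) (x : RN N) :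
    mollify ρ g x - g x = ∫ s, (g (x - s) - g x) * ρ s := by
  have hi : Integrable fun s => g (x - s) * ρ s := by
    have := (hg.integrable_smul_left_of_hasCompactSupport (hρ.comp_sub_left x).continuous
      (hρ.comp_sub_left x).2).comp_sub_left x
    simpa [mul_comm] using this
  simp only [sub_mul]
  rw [integral_sub hi (hρ.integrable.const_mul _), integral_const_mul, h1, mul_one,
    mollify_apply_swap]

/-- The error is a $\rho$-average of translation differences: Jensen at each point, then Tonelli,
and only shifts with $\rho(s)\ne0$ count. -/
theorem eLpNorm_mollify_sub_le {ρ g : RN N → ℝ} (hρ : IsTestFun ρ) (h0 : ∀ x, 0 ≤ ρ x)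
    (h1 : ∫ x, ρ x = 1) (hg : MemLp g 2 volume) {ε : ℝ≥0∞}
    (hε : ∀ s, ρ s ≠ 0 → eLpNorm (fun x => g (x - s) - g x) 2 volume ≤ ε) :
    eLpNorm (fun x => mollify ρ g x - g x) 2 volume ≤ ε := by
  -- Tonelli needs joint measurability of $(x,s)\mapsto g(x-s)$, hence the strongly measurable
  -- version.
  obtain ⟨g', hg'm, hgg'⟩ := hg.1
  have hg' : MemLp g' 2 volume := hg.ae_eq hgg'
  have ht : ∀ s : RN N, (fun x => g (x - s) - g x) =ᵐ[volume] fun x => g' (x - s) - g' x := by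
    intro s
    have := (measurePreserving_sub_right volume s).quasiMeasurePreserving.ae_eq_comp hgg'
    filter_upwards [this, hgg'] with x hx hx'
    simpa [hx'] using hx
  have heq : (fun x => mollify ρ g x - g x) =ᵐ[volume] fun x => mollify ρ g' x - g' x := by
    rw [mollify_congr ρ hgg']
    filter_upwards [hgg'] with x hx
    rw [hx]
  rw [eLpNorm_congr_ae heq, ← ENNReal.pow_le_pow_left_iff two_ne_zero, eLpNorm_two_sq]
  have hm : Measurable fun s => ENNReal.ofReal (ρ s) := hρ.continuous.measurable.ennreal_ofReal
  have hd : Measurable fun z : RN N × RN N => ‖g' (z.1 - z.2) - g' z.1‖ₑ ^ 2 :=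
    (((hg'm.measurable.comp (measurable_fst.sub measurable_snd)).sub
      (hg'm.measurable.comp measurable_fst)).enorm).pow_const 2
  have hd' : Measurable (Function.uncurry fun x s : RN N =>
      ENNReal.ofReal (ρ s) * ‖g' (x - s) - g' x‖ₑ ^ 2) := (hm.comp measurable_snd).mul hd
  calc ∫⁻ x, ‖mollify ρ g' x - g' x‖ₑ ^ 2
      ≤ ∫⁻ x, ∫⁻ s, ENNReal.ofReal (ρ s) * ‖g' (x - s) - g' x‖ₑ ^ 2 := by
        refine lintegral_mono fun x => ?_
        rw [mollify_sub_eq hρ h1 (hg'.locallyIntegrable (by norm_num))]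
        refine enorm_integral_mul_sq_le hρ h0 h1 ?_
        exact ((hg'm.measurable.comp (measurable_const.sub measurable_id)).sub
          measurable_const).stronglyMeasurable
    _ = ∫⁻ s, ∫⁻ x, ENNReal.ofReal (ρ s) * ‖g' (x - s) - g' x‖ₑ ^ 2 :=
        lintegral_lintegral_swap hd'.aemeasurable
    _ ≤ ∫⁻ s, ENNReal.ofReal (ρ s) * ε ^ 2 := by
        refine lintegral_mono fun s => ?_
        rw [lintegral_const_mul' _ _ ENNReal.ofReal_ne_top]
        by_cases hs : ρ s = 0
        · simp [hs]
        · rw [← eLpNorm_two_sq volume fun x => g' (x - s) - g' x, ← eLpNorm_congr_ae (ht s)]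
          gcongr
          exact hε s hs
    _ = ε ^ 2 := by
        rw [lintegral_mul_const _ hm, ← ofReal_integral_eq_lintegral_ofReal hρ.integrable
          (.of_forall h0), h1, ENNReal.ofReal_one, one_mul]

/-- A bump function supported in the ball of radius `1 / (n + 1)`. -/
def mollifierBump (N n : ℕ) : ContDiffBump (0 : RN N) where
  rIn := 1 / (n + 1) / 2
  rOut := 1 / (n + 1)
  rIn_pos := by positivity
  rIn_lt_rOut := half_lt_self (by positivity)

/-- A smooth probability density supported in the ball of radius `1 / (n + 1)`. -/
def mollifier (N n : ℕ) : RN N → ℝ := (mollifierBump N n).normed volume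

theorem isTestFun_mollifier (N n : ℕ) : IsTestFun (mollifier N n) :=
  ⟨ContDiffBump.contDiff_normed (n := ⊤) _, ContDiffBump.hasCompactSupport_normed _⟩

theorem norm_lt_of_mollifier_ne_zero {n : ℕ} {s : RN N} (hs : mollifier N n s ≠ 0) :
    ‖s‖ < 1 / ((n : ℝ) + 1) := by
  have h : s ∈ Function.support ((mollifierBump N n).normed volume) := hs
  rw [ContDiffBump.support_normed_eq] at h
  simpa [mollifierBump] using h

theorem tendsto_eLpNorm_mollify_sub {g : RN N → ℝ} (hg : MemLp g 2 volume) :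
    Tendsto (fun n => eLpNorm (fun x => mollify (mollifier N n) g x - g x) 2 volume)
      atTop (𝓝 0) := by
  rw [ENNReal.tendsto_nhds_zero]
  intro ε hε
  obtain ⟨δ, hδ, h⟩ := exists_eLpNorm_translate_sub_le hg hε
  have := (tendsto_one_div_add_atTop_nhds_zero_nat (𝕜 := ℝ)).eventually_lt_const hδ
  filter_upwards [this] with n hn
  exact eLpNorm_mollify_sub_le (isTestFun_mollifier N n) (fun x => ContDiffBump.nonneg_normed _ x)
    (ContDiffBump.integral_normed _) hg
    fun s hs => h s ((norm_lt_of_mollifier_ne_zero hs).trans hn)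

theorem MemL2Loc.locallyIntegrable {F : Type*} [NormedAddCommGroup F] {f : RN N → F}
    (hf : MemL2Loc f) : LocallyIntegrable f := by
  rw [locallyIntegrable_iff]
  intro K hK
  have : IsFiniteMeasure (volume.restrict K : Measure (RN N)) :=
    ⟨by simpa using hK.measure_lt_top⟩
  exact (hf K hK).integrable (by norm_num)

theorem IsTestFun.exists_bound {h : RN N → ℝ} (hh : IsTestFun h) :
    ∃ M : NNReal, ∀ x, ‖h x‖ ≤ M := by
  obtain ⟨M, hM⟩ := hh.2.exists_bound_of_continuous hh.continuous
  exact ⟨M.toNNReal, fun x => (hM x).trans (Real.le_coe_toNNReal M)⟩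

/-- Mollifications of `g ∈ L²_loc` converge to `g` in `L²_loc`. -/
theorem MemL2Loc.tendsto_eLpNorm_mul_mollify_sub {g h : RN N → ℝ} (hg : MemL2Loc g)
    (hh : IsTestFun h) :
    Tendsto (fun n => eLpNorm (fun x => h x * (mollify (mollifier N n) g x - g x)) 2 volume)
      atTop (𝓝 0) := by
  -- Mollification radii are at most $1$, so on the support of $h$ only values of $g$ in $K$ enter,
  -- and $g$ may be replaced by its $L^2$ truncation to $K$.
  set K := Metric.cthickening 1 (tsupport h)
  have hK : IsCompact K := hh.2.isCompact.cthickening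
  have hg0 : MemLp (K.indicator g) 2 volume := by
    rw [memLp_indicator_iff_restrict hK.measurableSet]
    exact hg K hK
  obtain ⟨M, hM⟩ := hh.exists_bound
  have hlim := ENNReal.Tendsto.const_mul (a := (M : ℝ≥0∞)) (tendsto_eLpNorm_mollify_sub hg0)
    (Or.inr ENNReal.coe_ne_top)
  rw [mul_zero] at hlim
  refine tendsto_of_tendsto_of_tendsto_of_le_of_le tendsto_const_nhds hlim (fun _ => zero_le) ?_
  intro n
  refine eLpNorm_le_nnreal_smul_eLpNorm_of_ae_le_mul (c := M) (.of_forall fun x => ?_) 2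
  by_cases hx : h x = 0
  · simp [hx]
  have hxs : x ∈ tsupport h := subset_tsupport h hx
  have e1 : K.indicator g x = g x :=
    Set.indicator_of_mem (Metric.self_subset_cthickening _ hxs) g
  have e2 : mollify (mollifier N n) (K.indicator g) x = mollify (mollifier N n) g x := by
    refine integral_congr_ae (.of_forall fun t => ?_)
    change K.indicator g t * mollifier N n (x - t) = g t * mollifier N n (x - t)
    by_cases ht : mollifier N n (x - t) = 0
    · simp [ht]
    · have h1 := norm_lt_of_mollifier_ne_zero ht
      have h2 : 1 / ((n : ℝ) + 1) ≤ 1 := by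
        rw [div_le_one (by positivity)]
        linarith [n.cast_nonneg (α := ℝ)]
      rw [Set.indicator_of_mem]
      refine Metric.mem_cthickening_of_dist_le t x 1 _ hxs ?_
      rw [dist_comm, dist_eq_norm]
      linarith
  rw [e1, e2]
  rw [← NNReal.coe_le_coe]
  push_cast
  rw [norm_mul]
  gcongr
  exact hM x

/-! ### Cutoff functions -/

theorem laplacian_mul {f g : RN N → ℝ} (hf : ContDiff ℝ ∞ f) (hg : ContDiff ℝ ∞ g) (x : RN N) :
    Δ (fun x => f x * g x) x = ∑ i, (f x * pderiv i (pderiv i g) x +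
      2 * pderiv i f x * pderiv i g x) + Δ f x * g x := by
  rw [laplacian_eq_sum_pderiv (hf.mul hg), laplacian_eq_sum_pderiv hf, Finset.sum_mul,
    ← Finset.sum_add_distrib]
  refine Finset.sum_congr rfl fun i _ => ?_
  rw [pderiv_mul hf hg, pderiv_add ((hf.pderiv i).mul hg) (hf.mul (hg.pderiv i)),
    pderiv_mul (hf.pderiv i) hg, pderiv_mul hf (hg.pderiv i)]
  ring

theorem pderiv_comp_smul {f : RN N → ℝ} (hf : ContDiff ℝ ∞ f) (c : ℝ) (i : Fin N) :
    pderiv i (fun x => f (c • x)) = fun x => c * pderiv i f (c • x) := by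
  funext x
  have h := (hf.differentiable_infty (c • x)).hasFDerivAt.comp x
    ((hasFDerivAt_id (𝕜 := ℝ) x).const_smul c)
  have h' : HasFDerivAt (fun x => f (c • x)) _ x := h
  rw [pderiv, h'.fderiv]
  simp [pderiv]

theorem laplacian_comp_smul {f : RN N → ℝ} (hf : ContDiff ℝ ∞ f) (c : ℝ) (x : RN N) :
    Δ (fun x => f (c • x)) x = c * (c * Δ f (c • x)) := by
  have e : ∀ i, pderiv i (pderiv i fun x => f (c • x)) x =
      c * (c * pderiv i (pderiv i f) (c • x)) := fun i => by
    have h1 : ContDiff ℝ ∞ fun x => c * pderiv i f x := contDiff_const.mul (hf.pderiv i)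
    have h2 : pderiv i (fun x => c * pderiv i f x) = fun x => c * pderiv i (pderiv i f) x := by
      rw [pderiv_mul contDiff_const (hf.pderiv i)]
      simp [pderiv]
    rw [pderiv_comp_smul hf, pderiv_comp_smul h1, h2]
  rw [laplacian_eq_sum_pderiv hf,
    laplacian_eq_sum_pderiv (f := fun x => f (c • x)) (hf.comp (contDiff_const_smul c))]
  simp only [e, Finset.mul_sum]

/-- A smooth function equal to `1` on the unit ball and supported in the ball of radius `2`. -/
def unitCutoff (N : ℕ) : ContDiffBump (0 : RN N) where
  rIn := 1
  rOut := 2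
  rIn_pos := one_pos
  rIn_lt_rOut := one_lt_two

/-- A smooth function equal to `1` on the ball of radius `c⁻¹` and supported in the ball of radius
`2 c⁻¹`. -/
def cutoff (N : ℕ) (c : ℝ) (x : RN N) : ℝ := unitCutoff N (c • x)

theorem isTestFun_unitCutoff (N : ℕ) : IsTestFun (unitCutoff N) :=
  ⟨(unitCutoff N).contDiff (n := ⊤), (unitCutoff N).hasCompactSupport⟩

theorem isTestFun_cutoff {c : ℝ} (hc : 0 < c) : IsTestFun (cutoff N c) :=
  ⟨(isTestFun_unitCutoff N).1.comp (contDiff_const_smul c),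
    (isTestFun_unitCutoff N).2.comp_homeomorph (Homeomorph.smulOfNeZero c hc.ne')⟩

theorem cutoff_eq_one {c : ℝ} (hc : 0 < c) {x : RN N} (hx : c * ‖x‖ ≤ 1) : cutoff N c x = 1 := by
  refine (unitCutoff N).one_of_mem_closedBall ?_
  simpa [norm_smul, abs_of_pos hc, unitCutoff] using hx

theorem cutoff_nonneg (c : ℝ) (x : RN N) : 0 ≤ cutoff N c x := (unitCutoff N).nonneg

theorem cutoff_le_one (c : ℝ) (x : RN N) : cutoff N c x ≤ 1 := (unitCutoff N).le_one

theorem cutoff_eventuallyEq_one {c : ℝ} (hc : 0 < c) {x : RN N} (hx : c * ‖x‖ < 1) :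
    cutoff N c =ᶠ[𝓝 x] fun _ => 1 := by
  have : ∀ᶠ y : RN N in 𝓝 x, c * ‖y‖ < 1 :=
    (continuous_const.mul continuous_norm).continuousAt.eventually_lt_const hx
  filter_upwards [this] with y hy using cutoff_eq_one hc hy.le

theorem pderiv_cutoff_eq_zero {c : ℝ} (hc : 0 < c) {x : RN N} (hx : c * ‖x‖ < 1) (i : Fin N) :
    pderiv i (cutoff N c) x = 0 := by
  rw [pderiv, (cutoff_eventuallyEq_one hc hx).fderiv_eq]
  simp

theorem laplacian_cutoff_eq_zero {c : ℝ} (hc : 0 < c) {x : RN N} (hx : c * ‖x‖ < 1) :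
    Δ (cutoff N c) x = 0 := by
  rw [(InnerProductSpace.laplacian_congr_nhds (cutoff_eventuallyEq_one hc hx)).eq_of_nhds]
  simp

theorem IsTestFun.exists_abs_mul_le {f g : RN N → ℝ} (hf : IsTestFun f) (hg : Continuous g) :
    ∃ C, ∀ x, |f x * g x| ≤ C :=
  HasCompactSupport.exists_bound_of_continuous (f := fun x => f x * g x) hf.2.mul_right
    (hf.continuous.mul hg)

/-- Scale invariance: $|x|\,|\partial_i\chi_c(x)|=|y|\,|\partial_i\chi(y)|$ at $y=cx$, and the right
side is bounded. The weight $|x|^{-1}$ matches the condition on $\nabla u/|x|$. -/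
theorem exists_pderiv_cutoff_bound (N : ℕ) : ∃ C : ℝ, ∀ c > 0, ∀ (i : Fin N) (x : RN N),
    |pderiv i (cutoff N c) x| ≤ C * ‖x‖⁻¹ := by
  have h := fun i => (isTestFun_unitCutoff N).pderiv i
  choose C hC using fun i => (h i).exists_abs_mul_le continuous_norm
  refine ⟨∑ i, C i, fun c hc i x => ?_⟩
  -- At the origin the right side is $0$, because `0⁻¹ = 0`; the cutoff is constant there.
  rcases eq_or_ne x 0 with rfl | hx
  · rw [pderiv_cutoff_eq_zero hc (by simp)]
    simp
  have h1 := hC i (c • x)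
  have h2 : C i ≤ ∑ i, C i := Finset.single_le_sum (f := C)
    (fun i _ => (abs_nonneg _).trans (hC i 0)) (Finset.mem_univ i)
  have h3 : 0 < ‖x‖ := norm_pos_iff.2 hx
  rw [← div_eq_mul_inv, le_div_iff₀ h3]
  refine le_trans (le_of_eq ?_) (h1.trans h2)
  have : pderiv i (cutoff N c) x = c * pderiv i (unitCutoff N) (c • x) :=
    congrFun (pderiv_comp_smul (isTestFun_unitCutoff N).1 c i) x
  simp only [this, norm_smul, abs_mul, Real.norm_eq_abs, abs_norm, abs_abs]
  ring

theorem exists_laplacian_cutoff_bound (N : ℕ) : ∃ C : ℝ, ∀ c > 0, ∀ x : RN N,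
    |Δ (cutoff N c) x| ≤ C * (‖x‖ ^ 2)⁻¹ := by
  obtain ⟨C, hC⟩ := (isTestFun_unitCutoff N).laplacian.exists_abs_mul_le (continuous_norm.pow 2)
  refine ⟨C, fun c hc x => ?_⟩
  rcases eq_or_ne x 0 with hx | hx
  · rw [laplacian_cutoff_eq_zero hc (by simp [hx])]
    simp [hx]
  have h3 : 0 < ‖x‖ := norm_pos_iff.2 hx
  rw [← div_eq_mul_inv, le_div_iff₀ (by positivity)]
  refine le_trans (le_of_eq ?_) (hC (c • x))
  have : Δ (cutoff N c) x = c * (c * Δ (unitCutoff N : RN N → ℝ) (c • x)) :=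
    laplacian_comp_smul (isTestFun_unitCutoff N).1 c x
  rw [this]
  generalize Δ (unitCutoff N : RN N → ℝ) (c • x) = L
  simp only [Pi.pow_apply, norm_smul, abs_mul, Real.norm_eq_abs, abs_norm, abs_abs, abs_pow]
  ring

/-! ### Approximation of functions in `𝒮²` -/

theorem tendsto_eLpNorm_add {α : Type*} [MeasurableSpace α] {μ : Measure α} {p : ℝ≥0∞}
    (hp : 1 ≤ p) {f g : ℕ → α → ℝ} (hf : ∀ n, AEStronglyMeasurable (f n) μ)
    (hg : ∀ n, AEStronglyMeasurable (g n) μ)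
    (h1 : Tendsto (fun n => eLpNorm (f n) p μ) atTop (𝓝 0))
    (h2 : Tendsto (fun n => eLpNorm (g n) p μ) atTop (𝓝 0)) :
    Tendsto (fun n => eLpNorm (fun x => f n x + g n x) p μ) atTop (𝓝 0) := by
  have h := h1.add h2
  rw [add_zero] at h
  exact tendsto_of_tendsto_of_tendsto_of_le_of_le tendsto_const_nhds h (fun _ => zero_le)
    fun n => eLpNorm_add_le (hf n) (hg n) hp

theorem tendsto_eLpNorm_sum {α ι : Type*} [MeasurableSpace α] {μ : Measure α} {p : ℝ≥0∞}
    (hp : 1 ≤ p) {f : ι → ℕ → α → ℝ} (s : Finset ι)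
    (hf : ∀ i n, AEStronglyMeasurable (f i n) μ)
    (h : ∀ i, Tendsto (fun n => eLpNorm (f i n) p μ) atTop (𝓝 0)) :
    Tendsto (fun n => eLpNorm (fun x => ∑ i ∈ s, f i n x) p μ) atTop (𝓝 0) := by
  have h' := tendsto_finsetSum s fun i _ => h i
  rw [Finset.sum_const_zero] at h'
  refine tendsto_of_tendsto_of_tendsto_of_le_of_le tendsto_const_nhds h' (fun _ => zero_le)
    fun n => ?_
  have := eLpNorm_sum_le (s := s) (fun i _ => hf i n) hp
  refine le_trans (le_of_eq (congrArg (fun F => eLpNorm F p μ) ?_)) this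
  funext x
  simp

theorem MemL2Loc.coord {G : RN N → RN N} (hG : MemL2Loc G) (i : Fin N) :
    MemL2Loc (fun x => G x i) := fun K hK => (hG K hK).eval_piLp i

/-- `Δ(χu)` for `u` with weak gradient `G` and weak Hessian `H`. -/
def cutoffLaplacian (χ u : RN N → ℝ) (G : RN N → RN N) (H : Fin N → RN N → RN N) (x : RN N) : ℝ :=
  ∑ i, (χ x * H i x i + 2 * pderiv i χ x * G x i) + Δ χ x * u x

/-- Expanded by the product rule, the error is a sum of fixed test functions times mollification
errors of $u$, $\nabla u$ and the diagonal Hessian entries, each of which is in $L^2_{loc}$. -/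
theorem HasH2LocDerivs.tendsto_laplacian_mul_mollify {u χ : RN N → ℝ} {G : RN N → RN N}
    {H : Fin N → RN N → RN N} (h : HasH2LocDerivs u G H) (hχ : IsTestFun χ) :
    Tendsto (fun n => eLpNorm (fun x => Δ (fun x => χ x * mollify (mollifier N n) u x) x -
      cutoffLaplacian χ u G H x) 2 volume) atTop (𝓝 0) := by
  have hm : ∀ {χ g : RN N → ℝ}, IsTestFun χ → LocallyIntegrable g → ∀ n, AEStronglyMeasurable
      (fun x => χ x * (mollify (mollifier N n) g x - g x)) volume := fun hχ hg n =>
    hχ.continuous.aestronglyMeasurable.mul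
      ((contDiff_mollify (isTestFun_mollifier N n) hg).continuous.aestronglyMeasurable.sub
        hg.aestronglyMeasurable)
  have hχ2 : ∀ i, IsTestFun fun x => 2 * pderiv i χ x := fun i =>
    (hχ.pderiv i).mul_left (contDiff_const (c := (2 : ℝ)))
  have hH := fun i => (h.memL2Loc_hess i).coord i
  have hG := fun i => h.memL2Loc_grad.coord i
  have t1 := fun i => tendsto_eLpNorm_add (p := 2) (by norm_num)
    (hm hχ (hH i).locallyIntegrable) (hm (hχ2 i) (hG i).locallyIntegrable)
    ((hH i).tendsto_eLpNorm_mul_mollify_sub hχ) ((hG i).tendsto_eLpNorm_mul_mollify_sub (hχ2 i))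
  have t2 := tendsto_eLpNorm_sum (p := 2) (by norm_num) Finset.univ
    (fun i n => (hm hχ (hH i).locallyIntegrable n).add (hm (hχ2 i) (hG i).locallyIntegrable n)) t1
  have t3 := tendsto_eLpNorm_add (p := 2) (by norm_num)
    (fun n => Finset.aestronglyMeasurable_fun_sum _ fun i _ =>
      (hm hχ (hH i).locallyIntegrable n).add (hm (hχ2 i) (hG i).locallyIntegrable n))
    (hm hχ.laplacian h.memL2Loc.locallyIntegrable) t2
    (h.memL2Loc.tendsto_eLpNorm_mul_mollify_sub hχ.laplacian)
  refine t3.congr fun n => ?_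
  congr 1
  funext x
  have hρ := isTestFun_mollifier N n
  rw [laplacian_mul hχ.1 (contDiff_mollify hρ h.memL2Loc.locallyIntegrable), cutoffLaplacian,
    add_sub_add_comm, ← Finset.sum_sub_distrib]
  congr 1
  · refine Finset.sum_congr rfl fun i _ => ?_
    rw [pderiv_mollify hρ h.weakGradient, pderiv_mollify hρ (h.weakHessian i)]
    simp only [Pi.add_apply]
    ring
  · ring

theorem tendsto_eLpNorm_indicator_norm_ge {g : RN N → ℝ} (hg : MemLp g 2 volume) :
    Tendsto (fun n : ℕ => eLpNorm ({x : RN N | (n : ℝ) + 1 ≤ ‖x‖}.indicator g) 2 volume)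
      atTop (𝓝 0) := by
  have hmeas : ∀ n : ℕ, MeasurableSet {x : RN N | (n : ℝ) + 1 ≤ ‖x‖} := fun n =>
    measurableSet_le measurable_const measurable_norm
  have h : Tendsto (fun n : ℕ => eLpNorm ({x : RN N | (n : ℝ) + 1 ≤ ‖x‖}.indicator g) 2 volume ^ 2)
      atTop (𝓝 0) := by
    simp only [eLpNorm_two_sq]
    rw [← lintegral_zero (μ := (volume : Measure (RN N)))]
    refine tendsto_lintegral_of_dominated_convergence' (fun x => ‖g x‖ₑ ^ 2)
      (fun n => ((hg.1.indicator (hmeas n)).enorm).pow_const 2)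
      (fun n => .of_forall fun x => ?_) ?_ (.of_forall fun x => ?_)
    · exact pow_le_pow_left₀ zero_le (enorm_indicator_le_enorm_self g x) 2
    · rw [← eLpNorm_two_sq]
      exact (ENNReal.pow_lt_top hg.2).ne
    · refine tendsto_const_nhds.congr' ?_
      filter_upwards [eventually_gt_atTop ⌈‖x‖⌉₊] with n hn
      rw [Set.indicator_of_notMem]
      · simp
      · have := Nat.lt_of_ceil_lt hn
        simp only [Set.mem_ofPred_eq, not_le]
        linarith
  have h' := (ENNReal.continuous_rpow_const (y := (1 / 2 : ℝ))).continuousAt.tendsto.comp h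
  simp only [Function.comp_def, ← ENNReal.rpow_natCast, ← ENNReal.rpow_mul] at h'
  simpa using h'

theorem tendsto_cutoffLaplacian {u : RN N → ℝ} {G : RN N → RN N}
    {H : Fin N → RN N → RN N} (hf : MemLp (hessTrace H) 2 volume)
    (hG : MemLp (fun x => ‖x‖⁻¹ • G x) 2 volume) (hu : MemLp (fun x => u x / ‖x‖ ^ 2) 2 volume) :
    Tendsto (fun n : ℕ => eLpNorm (fun x =>
      cutoffLaplacian (cutoff N ((n : ℝ) + 1)⁻¹) u G H x - hessTrace H x) 2 volume)
      atTop (𝓝 0) := by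
  obtain ⟨C, hC⟩ := exists_pderiv_cutoff_bound N
  obtain ⟨C', hC'⟩ := exists_laplacian_cutoff_bound N
  have hGi : ∀ i, MemLp (fun x => ‖x‖⁻¹ * G x i) 2 volume := fun i => by
    simpa using hG.eval_piLp i
  -- An $L^2$ majorant independent of $n$, with one summand for each condition defining $\mathcal
  -- S^2$. The error vanishes for $|x|<n+1$, so it is bounded by a tail of `g`.
  set g : RN N → ℝ := fun x => |hessTrace H x| + ∑ i, 2 * C * |‖x‖⁻¹ * G x i| +
    C' * |u x / ‖x‖ ^ 2| with hg
  have hgm : MemLp g 2 volume :=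
    (hf.abs.add (memLp_finsetSum _ fun i _ => (hGi i).abs.const_mul (2 * C))).add
      (hu.abs.const_mul C')
  refine tendsto_of_tendsto_of_tendsto_of_le_of_le tendsto_const_nhds
    (tendsto_eLpNorm_indicator_norm_ge hgm) (fun _ => zero_le) fun n => ?_
  refine eLpNorm_mono_real fun x => ?_
  have hn : (0 : ℝ) < (n : ℝ) + 1 := by positivity
  have hc : (0 : ℝ) < ((n : ℝ) + 1)⁻¹ := by positivity
  set c := ((n : ℝ) + 1)⁻¹ with hcdef
  by_cases hx : (n : ℝ) + 1 ≤ ‖x‖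
  · rw [Set.indicator_of_mem (show x ∈ {x : RN N | (n : ℝ) + 1 ≤ ‖x‖} from hx)]
    have e : cutoffLaplacian (cutoff N c) u G H x - hessTrace H x =
        (cutoff N c x - 1) * hessTrace H x + ∑ i, 2 * pderiv i (cutoff N c) x * G x i +
          Δ (cutoff N c) x * u x := by
      rw [cutoffLaplacian, hessTrace, Finset.sum_add_distrib, ← Finset.mul_sum]
      ring
    rw [e, hg]
    refine norm_add₃_le.trans (add_le_add (add_le_add ?_ ?_) ?_)
    · rw [Real.norm_eq_abs, abs_mul]
      refine mul_le_of_le_one_left (abs_nonneg _) ?_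
      rw [abs_le]
      constructor <;> linarith [cutoff_nonneg c x, cutoff_le_one c x]
    · refine (norm_sum_le _ _).trans (Finset.sum_le_sum fun i _ => ?_)
      rw [Real.norm_eq_abs, abs_mul, abs_mul, abs_two, abs_mul, abs_of_nonneg (by positivity : 0 ≤ ‖x‖⁻¹)]
      have := mul_le_mul_of_nonneg_right (hC c hc i x) (abs_nonneg (G x i))
      linarith
    · rw [Real.norm_eq_abs, abs_mul, div_eq_mul_inv, abs_mul,
        abs_of_nonneg (by positivity : 0 ≤ (‖x‖ ^ 2)⁻¹)]
      have := mul_le_mul_of_nonneg_right (hC' c hc x) (abs_nonneg (u x))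
      linarith
  · rw [Set.indicator_of_notMem (show x ∉ {x : RN N | (n : ℝ) + 1 ≤ ‖x‖} from hx)]
    have hx' : c * ‖x‖ < 1 := by
      rw [hcdef, inv_mul_lt_iff₀ hn]
      linarith
    simp [cutoffLaplacian, hessTrace, cutoff_eq_one hc hx'.le, pderiv_cutoff_eq_zero hc hx',
      laplacian_cutoff_eq_zero hc hx']

theorem HasH2LocDerivs.memL2Loc_hessTrace {u : RN N → ℝ} {G : RN N → RN N}
    {H : Fin N → RN N → RN N} (h : HasH2LocDerivs u G H) : MemL2Loc (hessTrace H) :=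
  fun K hK => memLp_finsetSum _ fun i _ => (h.memL2Loc_hess i).coord i K hK

/-- `hessTrace H` is the distributional Laplacian of `u`. -/
theorem HasH2LocDerivs.integral_hessTrace_mul {u : RN N → ℝ} {G : RN N → RN N}
    {H : Fin N → RN N → RN N} (h : HasH2LocDerivs u G H) {η : RN N → ℝ} (hη : IsTestFun η) :
    ∫ x, hessTrace H x * η x = ∫ x, u x * Δ η x := by
  have hi : ∀ {f g : RN N → ℝ}, LocallyIntegrable f → IsTestFun g →
      Integrable fun x => f x * g x := fun hf hg => by
    simpa [mul_comm] using hf.integrable_smul_left_of_hasCompactSupport hg.continuous hg.2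
  simp only [hessTrace, laplacian_eq_sum_pderiv hη.1, Finset.sum_mul, Finset.mul_sum]
  rw [integral_finsetSum _ fun i _ => hi ((h.memL2Loc_hess i).coord i).locallyIntegrable hη,
    integral_finsetSum _ fun i _ => hi h.memL2Loc.locallyIntegrable ((hη.pderiv i).pderiv i)]
  refine Finset.sum_congr rfl fun i _ => ?_
  have h1 := h.weakGradient.integral_eq _ (hη.pderiv i).1 (hη.pderiv i).2 i
  have h2 := (h.weakHessian i).integral_eq _ hη.1 hη.2 i
  change ∫ x, u x * pderiv i (pderiv i η) x = -∫ x, G x i * pderiv i η x at h1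
  change ∫ x, G x i * pderiv i η x = -∫ x, H i x i * η x at h2
  rw [h1, h2, neg_neg]

theorem Represents.memLp {ξ : DCompletion N} {u : RN N →ₘ[volume] ℝ}
    (h : Represents ξ u) : MemLp u (sobolevExponent N) volume := by
  obtain ⟨φ, -, hφu⟩ := h
  exact memLp_of_tendsto_eLpNorm_sub (fun n => (φ n).isTestFun.memLp _) u.aestronglyMeasurable hφu

theorem tendsto_norm_of_tendsto_completion {φ : ℕ → TestSpace N} {ξ : DCompletion N}
    (h : Tendsto (fun n => (φ n : DCompletion N)) atTop (𝓝 ξ)) :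
    Tendsto (fun n => eLpNorm (Δ (φ n : RN N → ℝ)) 2 volume) atTop (𝓝 (ENNReal.ofReal ‖ξ‖)) := by
  have := (ENNReal.continuous_ofReal.tendsto _).comp h.norm
  simpa only [Function.comp_def, UniformSpace.Completion.norm_coe, ← TestSpace.eLpNorm_laplacian]
    using this

/-- A representative of `ξ` has a distributional Laplacian in `L²` whose norm is `‖ξ‖`. -/
theorem Represents.exists_laplacian (hN : 4 < N) {ξ : DCompletion N} {u : RN N →ₘ[volume] ℝ}
    (h : Represents ξ u) : ∃ f : RN N → ℝ, MemLp f 2 volume ∧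
      (∀ η, IsTestFun η → ∫ x, f x * η x = ∫ x, u x * Δ η x) ∧
      eLpNorm f 2 volume = ENNReal.ofReal ‖ξ‖ := by
  have hu := h.memLp
  obtain ⟨φ, hφξ, hφu⟩ := h
  have hp1 : 1 ≤ sobolevExponent N := le_trans (by norm_num) (two_le_sobolevExponent hN)
  obtain ⟨f, hf, hφf⟩ := exists_tendsto_eLpNorm_laplacian (cauchySeq_of_tendsto_completion hφξ)
  refine ⟨f, hf, fun η hη => ?_, ?_⟩
  · have t1 := tendsto_integral_mul_of_tendsto_eLpNorm (by norm_num)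
      (fun n => (φ n).memLp_laplacian) hf hφf hη
    have t2 := tendsto_integral_mul_of_tendsto_eLpNorm hp1 (fun n => (φ n).isTestFun.memLp _) hu
      hφu hη.laplacian
    refine tendsto_nhds_unique t1 (t2.congr fun n => ?_)
    rw [integral_mul_laplacian (φ n).isTestFun.1 hη]
  · have t1 := tendsto_norm_of_tendsto_completion hφξ
    have hF : Tendsto (fun n => (φ n).memLp_laplacian.toLp) atTop (𝓝 hf.toLp) := by
      rw [Lp.tendsto_Lp_iff_tendsto_eLpNorm'' (fun n => Δ (φ n : RN N → ℝ))]
      exact hφf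
    have t2 := (ENNReal.continuous_ofReal.tendsto _).comp hF.norm
    simp only [Function.comp_def, Lp.norm_toLp, ENNReal.ofReal_toReal hf.eLpNorm_ne_top,
      ENNReal.ofReal_toReal (TestSpace.memLp_laplacian _).eLpNorm_ne_top] at t2
    exact tendsto_nhds_unique t2 t1

/-- The $L^2$ limit of $\Delta\varphi_n$ and the Hessian trace are both distributional Laplacians of
$u$, so they agree a.e., whichever weak derivatives are chosen. -/
theorem Represents.eLpNorm_hessTrace (hN : 4 < N) {ξ : DCompletion N} {u : RN N →ₘ[volume] ℝ}
    (h : Represents ξ u) {G : RN N → RN N} {H : Fin N → RN N → RN N}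
    (hH : HasH2LocDerivs u G H) : eLpNorm (hessTrace H) 2 volume = ENNReal.ofReal ‖ξ‖ := by
  obtain ⟨f, hf, hfu, hfξ⟩ := h.exists_laplacian hN
  rw [← hfξ]
  refine eLpNorm_congr_ae (ae_eq_of_integral_mul_eq hH.memL2Loc_hessTrace.locallyIntegrable
    (hf.locallyIntegrable (by norm_num)) fun η hη => ?_)
  rw [hH.integral_hessTrace_mul hη, hfu η hη]

theorem Represents.sub (hN : 4 < N) {ξ ξ' : DCompletion N} {u u' : RN N →ₘ[volume] ℝ}
    (h : Represents ξ u) (h' : Represents ξ' u') : Represents (ξ - ξ') (u - u') := by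
  obtain ⟨φ, hφξ, hφu⟩ := h
  obtain ⟨ψ, hψξ, hψu⟩ := h'
  refine ⟨fun n => φ n - ψ n, ?_, ?_⟩
  · simpa only [UniformSpace.Completion.coe_sub] using hφξ.sub hψξ
  · have hp1 : 1 ≤ sobolevExponent N := le_trans (by norm_num) (two_le_sobolevExponent hN)
    have hm : ∀ (φ : TestSpace N) (u : RN N →ₘ[volume] ℝ),
        AEStronglyMeasurable (fun x => (φ : RN N → ℝ) x - u x) volume := fun φ u =>
      φ.isTestFun.continuous.aestronglyMeasurable.sub u.aestronglyMeasurable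
    have hψu' : Tendsto (fun n => eLpNorm (fun x => -((ψ n : RN N → ℝ) x - u' x))
        (sobolevExponent N) volume) atTop (𝓝 0) :=
      hψu.congr fun n => (eLpNorm_neg (fun x => (ψ n : RN N → ℝ) x - u' x) _ _).symm
    refine (tendsto_eLpNorm_add hp1 (fun n => hm (φ n) u) (fun n => (hm (ψ n) u').neg)
      hφu hψu').congr fun n => eLpNorm_congr_ae ?_
    filter_upwards [AEEqFun.coeFn_sub u u'] with x hx
    rw [hx, TestSpace.sub_apply]
    simp
    ring

theorem Represents.eLpNorm_le (hN : 4 < N) : ∃ C : NNReal, ∀ (ξ : DCompletion N)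
    (u : RN N →ₘ[volume] ℝ), Represents ξ u →
      eLpNorm u (sobolevExponent N) volume ≤ C * ENNReal.ofReal ‖ξ‖ := by
  obtain ⟨C, hC⟩ := exists_eLpNorm_le hN
  refine ⟨C, fun ξ u ⟨φ, hφξ, hφu⟩ => ?_⟩
  have hp1 : 1 ≤ sobolevExponent N := le_trans (by norm_num) (two_le_sobolevExponent hN)
  have t := (ENNReal.Tendsto.const_mul (a := (C : ℝ≥0∞)) (tendsto_norm_of_tendsto_completion hφξ)
    (Or.inr ENNReal.coe_ne_top)).add hφu
  rw [add_zero] at t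
  refine ge_of_tendsto' t fun n => ?_
  have hm := (φ n).isTestFun.continuous.aestronglyMeasurable (μ := volume)
  have := eLpNorm_sub_le hm (hm.sub u.aestronglyMeasurable) hp1
  rw [sub_sub_cancel] at this
  refine this.trans ?_
  gcongr
  · exact hC _ (φ n).isTestFun
  · exact le_rfl

/-- The difference represents $0$, and the Sobolev bound forces it to vanish. -/
theorem Represents.eq (hN : 4 < N) {ξ : DCompletion N} {u u' : RN N →ₘ[volume] ℝ}
    (h : Represents ξ u) (h' : Represents ξ u') : u = u' := by
  obtain ⟨C, hC⟩ := Represents.eLpNorm_le hN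
  have h1 := hC _ _ (h.sub hN h')
  rw [sub_self, norm_zero, ENNReal.ofReal_zero, mul_zero, nonpos_iff_eq_zero,
    eLpNorm_eq_zero_iff (u - u').aestronglyMeasurable
      (by have := two_le_sobolevExponent hN; positivity)] at h1
  refine sub_eq_zero.1 (AEEqFun.ext (h1.trans AEEqFun.coeFn_zero.symm))

/-- The zero function represents $\xi-\xi'$. Its distributional Laplacian is $0$, and the $L^2$ norm
of that Laplacian is $\|\xi-\xi'\|$. -/
theorem Represents.eq_of_represents (hN : 4 < N) {ξ ξ' : DCompletion N} {u : RN N →ₘ[volume] ℝ}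
    (h : Represents ξ u) (h' : Represents ξ' u) : ξ = ξ' := by
  obtain ⟨f, hf, hfu, hfξ⟩ := (h.sub hN h').exists_laplacian hN
  have h0 : f =ᵐ[volume] fun _ => 0 := by
    refine ae_eq_of_integral_mul_eq (hf.locallyIntegrable (by norm_num))
      (locallyIntegrable_const 0) fun η hη => ?_
    rw [hfu η hη]
    refine integral_congr_ae ?_
    rw [sub_self]
    filter_upwards [AEEqFun.coeFn_zero (α := RN N) (β := ℝ) (μ := volume)] with x hx
    simp [hx]
  rw [eLpNorm_congr_ae h0, eLpNorm_zero', eq_comm, ENNReal.ofReal_eq_zero] at hfξ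
  exact sub_eq_zero.1 (norm_le_zero_iff.1 hfξ)

theorem exists_represents (hN : 4 < N) (ξ : DCompletion N) :
    ∃ u : RN N →ₘ[volume] ℝ, Represents ξ u := by
  obtain ⟨φ, hφ⟩ := exists_seq_tendsto_completion ξ
  obtain ⟨u, hu, hφu⟩ := exists_tendsto_eLpNorm_sobolev hN (cauchySeq_of_tendsto_completion hφ)
  refine ⟨AEEqFun.mk u hu.1, φ, hφ, hφu.congr fun n => eLpNorm_congr_ae ?_⟩
  filter_upwards [AEEqFun.coeFn_mk u hu.1] with x hx
  rw [hx]

theorem cauchySeq_of_tendsto_laplacian {φ : ℕ → TestSpace N} {f : RN N → ℝ} (hf : MemLp f 2 volume)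
    (h : Tendsto (fun n => eLpNorm (fun x => Δ (φ n : RN N → ℝ) x - f x) 2 volume) atTop (𝓝 0)) :
    CauchySeq φ := by
  have hF : Tendsto (fun n => laplacianToLp N (φ n)) atTop (𝓝 hf.toLp) := by
    refine (Lp.tendsto_Lp_iff_tendsto_eLpNorm'' (fun n => Δ (φ n : RN N → ℝ))
      (fun n => (φ n).memLp_laplacian) f hf).2 h
  have hL : Isometry (laplacianToLp N) := AddMonoidHomClass.isometry_of_norm _ fun _ => rfl
  refine hL.isUniformInducing.cauchy_map_iff.1 ?_
  rw [Filter.map_map]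
  exact hF.cauchySeq

/-- Functions in `𝒮²` are approximated by test functions. -/
theorem exists_testSpace_tendsto {u : RN N → ℝ} {G : RN N → RN N} {H : Fin N → RN N → RN N}
    (h : HasH2LocDerivs u G H) (hf : MemLp (hessTrace H) 2 volume)
    (hG : MemLp (fun x => ‖x‖⁻¹ • G x) 2 volume) (hu : MemLp (fun x => u x / ‖x‖ ^ 2) 2 volume) :
    ∃ φ : ℕ → TestSpace N,
      Tendsto (fun n => eLpNorm (fun x => Δ (φ n : RN N → ℝ) x - hessTrace H x) 2 volume)
        atTop (𝓝 0) ∧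
      Tendsto (fun n => eLpNorm (fun x => (φ n : RN N → ℝ) x -
        cutoff N ((n : ℝ) + 1)⁻¹ x * u x) 2 volume) atTop (𝓝 0) := by
  have hc : ∀ n : ℕ, (0 : ℝ) < ((n : ℝ) + 1)⁻¹ := fun n => by positivity
  set χ : ℕ → RN N → ℝ := fun n => cutoff N ((n : ℝ) + 1)⁻¹
  have hχ : ∀ n, IsTestFun (χ n) := fun n => isTestFun_cutoff (hc n)
  have hsmooth : ∀ k, ContDiff ℝ ∞ (mollify (mollifier N k) u) := fun k =>
    contDiff_mollify (isTestFun_mollifier N k) h.memL2Loc.locallyIntegrable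
  -- Diagonal choice: for each cutoff the mollification index is taken so large that both errors are
  -- at most $1/(n+1)$.
  have hex : ∀ n : ℕ, ∃ φ : TestSpace N,
      eLpNorm (fun x => Δ (φ : RN N → ℝ) x - cutoffLaplacian (χ n) u G H x) 2 volume ≤
        ENNReal.ofReal (1 / ((n : ℝ) + 1)) ∧
      eLpNorm (fun x => (φ : RN N → ℝ) x - χ n x * u x) 2 volume ≤
        ENNReal.ofReal (1 / ((n : ℝ) + 1)) := by
    intro n
    have hpos : 0 < ENNReal.ofReal (1 / ((n : ℝ) + 1)) := by
      rw [ENNReal.ofReal_pos]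
      positivity
    have e1 := ENNReal.tendsto_nhds_zero.1 (h.tendsto_laplacian_mul_mollify (hχ n)) _ hpos
    have e2 := ENNReal.tendsto_nhds_zero.1
      (h.memL2Loc.tendsto_eLpNorm_mul_mollify_sub (hχ n)) _ hpos
    obtain ⟨k, h1, h2⟩ := (e1.and e2).exists
    refine ⟨⟨fun x => χ n x * mollify (mollifier N k) u x, (hχ n).1.mul (hsmooth k),
      (hχ n).2.mul_right⟩, h1, le_trans (le_of_eq ?_) h2⟩
    congr 1
    funext x
    exact (mul_sub _ _ _).symm
  choose φ h1 h2 using hex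
  have hlim : Tendsto (fun n : ℕ => ENNReal.ofReal (1 / ((n : ℝ) + 1))) atTop (𝓝 0) := by
    simpa [Function.comp_def] using (ENNReal.continuous_ofReal.tendsto 0).comp
      (tendsto_one_div_add_atTop_nhds_zero_nat (𝕜 := ℝ))
  refine ⟨φ, ?_, tendsto_of_tendsto_of_tendsto_of_le_of_le tendsto_const_nhds hlim
    (fun _ => zero_le) h2⟩
  have hA : ∀ n, AEStronglyMeasurable (cutoffLaplacian (χ n) u G H) volume := fun n =>
    (Finset.aestronglyMeasurable_fun_sum _ fun i _ =>
      ((hχ n).continuous.aestronglyMeasurable.mul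
        ((h.memL2Loc_hess i).coord i).locallyIntegrable.aestronglyMeasurable).add
      (((hχ n).pderiv i).continuous.aestronglyMeasurable.const_mul 2 |>.mul
        (h.memL2Loc_grad.coord i).locallyIntegrable.aestronglyMeasurable)).add
      ((hχ n).laplacian.continuous.aestronglyMeasurable.mul
        h.memL2Loc.locallyIntegrable.aestronglyMeasurable)
  refine (tendsto_eLpNorm_add (p := 2) (by norm_num)
    (fun n => (φ n).memLp_laplacian.1.sub (hA n)) (fun n => (hA n).sub hf.1)
    (tendsto_of_tendsto_of_tendsto_of_le_of_le tendsto_const_nhds hlim (fun _ => zero_le) h1)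
    (tendsto_cutoffLaplacian hf hG hu)).congr fun n => ?_
  congr 1
  funext x
  simp

/-- `𝒮² ⊆ D^{2,2}_0`. -/
theorem exists_represents_of_mem_sSpace (hN : 4 < N) {u : RN N →ₘ[volume] ℝ} (hu : u ∈ SSpace N) :
    ∃ ξ : DCompletion N, Represents ξ u := by
  obtain ⟨G, H, h, hf, hG, hu⟩ := hu
  obtain ⟨φ, hφf, hφu⟩ := exists_testSpace_tendsto h hf hG hu
  have hφ := cauchySeq_of_tendsto_laplacian hf hφf
  obtain ⟨ξ, hξ⟩ := cauchySeq_tendsto_of_complete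
    ((UniformSpace.Completion.uniformContinuous_coe (TestSpace N)).comp_cauchySeq hφ)
  obtain ⟨v, hv, hφv⟩ := exists_tendsto_eLpNorm_sobolev hN hφ
  have hp1 : 1 ≤ sobolevExponent N := le_trans (by norm_num) (two_le_sobolevExponent hN)
  have hloc := h.memL2Loc.locallyIntegrable
  have hi : ∀ {g : RN N → ℝ}, IsTestFun g → Integrable fun x => u x * g x := fun hg => by
    simpa [mul_comm] using hloc.integrable_smul_left_of_hasCompactSupport hg.continuous hg.2
  have hχ : ∀ n : ℕ, IsTestFun (cutoff N ((n : ℝ) + 1)⁻¹) := fun n =>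
    isTestFun_cutoff (by positivity)
  -- So far $u$ is only in $L^2_{loc}$. Tested against $\eta$, $\varphi_n$ converges both to $v$ and
  -- to $u$, since $\varphi_n-\chi_nu\to0$ in $L^2$ and $\chi_n=1$ on the support of $\eta$ for
  -- large $n$.
  have huv : u =ᵐ[volume] v := by
    refine ae_eq_of_integral_mul_eq hloc (hv.locallyIntegrable hp1) fun η hη => ?_
    have hχu : ∀ n : ℕ, MemLp (fun x => cutoff N ((n : ℝ) + 1)⁻¹ x * u x) 2 volume := fun n => by
      obtain ⟨M, hM⟩ := (hχ n).exists_bound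
      have hK := (hχ n).2.isCompact
      refine ((((memLp_indicator_iff_restrict hK.measurableSet).2
        (h.memL2Loc _ hK)).norm.const_mul (M : ℝ))).mono
        ((hχ n).continuous.aestronglyMeasurable.mul u.aestronglyMeasurable)
        (.of_forall fun x => ?_)
      by_cases hx : x ∈ tsupport (cutoff N ((n : ℝ) + 1)⁻¹)
      · rw [Set.indicator_of_mem hx, norm_mul, norm_mul, norm_norm]
        gcongr
        exact (hM x).trans (le_abs_self _)
      · rw [image_eq_zero_of_notMem_tsupport hx, zero_mul, norm_zero]
        exact norm_nonneg _
    have t1 := tendsto_integral_mul_of_tendsto_eLpNorm hp1 (fun n => (φ n).isTestFun.memLp _) hv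
      hφv hη
    have t2 := tendsto_integral_mul_of_tendsto_eLpNorm (p := 2) (by norm_num)
      (f := fun n x => (φ n : RN N → ℝ) x - cutoff N ((n : ℝ) + 1)⁻¹ x * u x) (g := fun _ => 0)
      (fun n => ((φ n).isTestFun.memLp 2).sub (hχu n)) (MemLp.zero) (by simpa using hφu) hη
    have t3 := t2.add_const (∫ x, u x * η x)
    simp only [zero_mul, integral_zero, zero_add] at t3
    refine tendsto_nhds_unique (t3.congr' ?_) t1
    obtain ⟨R, hR⟩ := hη.2.isCompact.isBounded.exists_norm_le
    filter_upwards [eventually_ge_atTop ⌈R⌉₊] with n hn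
    have hn' : R ≤ n := (Nat.le_ceil R).trans (by exact_mod_cast hn)
    have hχη : ∀ x, cutoff N ((n : ℝ) + 1)⁻¹ x * η x = η x := fun x => by
      by_cases hx : η x = 0
      · simp [hx]
      · rw [cutoff_eq_one (by positivity), one_mul]
        rw [inv_mul_le_one₀ (by positivity)]
        linarith [hR x (subset_tsupport η hx)]
    have hsplit : ∀ x, ((φ n : RN N → ℝ) x - cutoff N ((n : ℝ) + 1)⁻¹ x * u x) * η x =
        (φ n : RN N → ℝ) x * η x - u x * η x := fun x => by
      rw [sub_mul, mul_right_comm, hχη x, mul_comm (η x)]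
    simp only [hsplit]
    rw [integral_sub (integrable_mul_of_hasCompactSupport (φ n).isTestFun.continuous hη.continuous
      hη.2) (hi hη), sub_add_cancel]
  refine ⟨ξ, φ, hξ, hφv.congr fun n => eLpNorm_congr_ae ?_⟩
  filter_upwards [huv] with x hx
  rw [hx]

end

/-- The first three conjuncts say that the completion `D^{2,2}_0(ℝ^N)` is, isometrically, a space
of functions; the last one says that this space of functions is `𝒮²(ℝ^N)`. -/
theorem mainTheorem8 (N : ℕ) (hN : 4 < N) :
    (∀ ξ : DCompletion N, ∃! u : RN N →ₘ[volume] ℝ, Represents ξ u) ∧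
    (∀ (ξ ξ' : DCompletion N) (u : RN N →ₘ[volume] ℝ),
      Represents ξ u → Represents ξ' u → ξ = ξ') ∧
    (∀ (ξ : DCompletion N) (u : RN N →ₘ[volume] ℝ), Represents ξ u →
      ∀ (G : RN N → RN N) (H : Fin N → RN N → RN N), HasH2LocDerivs u G H →
        eLpNorm (hessTrace H) 2 volume = ENNReal.ofReal ‖ξ‖) ∧
    DSpace N = SSpace N := by
  refine ⟨fun ξ => ?_, fun ξ ξ' u h h' => h.eq_of_represents hN h',
    fun ξ u h G H hH => h.eLpNorm_hessTrace hN hH, Set.Subset.antisymm ?_ ?_⟩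
  · obtain ⟨u, hu⟩ := exists_represents hN ξ
    exact ⟨u, hu, fun u' hu' => hu'.eq hN hu⟩
  · rintro u ⟨ξ, hξ⟩
    exact hξ.mem_sSpace hN
  · exact fun u hu => exists_represents_of_mem_sSpace hN hu
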